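/- **Theorem 3.** Let $g\ge 0$, $N=2g+1$, and let $\alpha=(\alpha_1,\dots,\alpha_N)$ be complex numbers. Let $R\in\mathbb C[\lambda]$ be $\alpha$-admissible, i.e. $R=S^2+\prod_{i=1}^N(\lambda-\alpha_i)$ for some polynomial $S$ of degree at most $g$, and assume that the roots of $R$ are distinct. Let $\Gamma_R$ be the hyperelliptic curve $\mu^2=R(\lambda)$ with its affine part $\Gamma_R^{\mathrm{aff}}$ and its point at infinity $P_\infty$, and let $\tau(\lambda,\mu)=(\lambda,-\mu)$. Meromorphic functions on $\Gamma_R$ are the elements of $\mathbb C(\lambda,\sqrt R)$, $\sqrt R=\mu$, and $L(E)$ is the space of those whose poles are bounded by the positive divisor $E$; $\varphi\sim\sqrt\lambda$ at infinity refers to the branch of $\sqrt\lambda$ near $P_\infty$ for which $\mu\sim\lambda^g\sqrt\lambda$. Let $M_R^\alpha$ be the set of $\alpha$-triples with discriminant $R$, that is, of triples $(A,B,C)$ of polynomials with $A$ monic of degree $g$, $C$ of degree $g+1$ with leading coefficient $-1$, $\deg B\le g$ and $B^2-AC=R$. Let $P_R^\alpha\subset M_R^\alpha$ be the subset given by $C(\alpha_N)=0$.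 Let $J(\Gamma_R)^{\mathrm{aff}}$ be the set of non-special positive divisors $D=P_1+\dots+P_g$, $P_i\in\Gamma_R^{\mathrm{aff}}$, where non-special means $P_i\ne\tau(P_j)$ for $i\ne j$. To $T=(A,B,C)\in M_R^\alpha$ corresponds the function $\varphi_T=(-B+\sqrt R)/A$. 1. There is a bijection $M_R^\alpha\to J(\Gamma_R)^{\mathrm{aff}}\times\mathbb C$, $T\mapsto(D_T,\beta_T)$, where $D_T+P_\infty$ is the divisor of poles of $\varphi_T$ and $\beta_T$ is the coefficient of $\lambda^g$ in $B$; explicitly $D_T=\sum_i(\lambda_i,-B(\lambda_i))$, the sum over the roots $\lambda_i$ of $A$ with multiplicity. Moreover $\varphi_T\sim\sqrt\lambda$ at infinity, and $T$ is determined by $\varphi_T$. 2. For every $D\in J(\Gamma_R)^{\mathrm{aff}}$ the functions $\varphi_T$ with $D_T=D$ are exactly the $\varphi\in L(D+P_\infty)$ with $\varphi\sim\sqrt\lambda$ at infinity. The functions $\varphi_T$, $T\in M_R^\alpha$, are exactly the meromorphic functions $\varphi$ on $\Gamma_R$ with $\varphi\sim\sqrt\lambda$ at infinity whose divisor of poles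 is $D+P_\infty$ for some $D\in J(\Gamma_R)^{\mathrm{aff}}$. 3. (Pure periodic case.) Assume $R(\alpha_N)\neq0$. The map $P_R^\alpha\to J(\Gamma_R)^{\mathrm{aff}}$, $T\mapsto D_T$, is generically $2:1$: the fibre over $D$ has exactly two elements if no point of $D$ has $\lambda$-coordinate $\alpha_N$, and exactly one element otherwise. For every $D\in J(\Gamma_R)^{\mathrm{aff}}$ the functions $\varphi_T$ with $T\in P_R^\alpha$, $D_T=D$ are exactly the $\varphi\in L(D+P_\infty)$ with $\varphi\sim\sqrt\lambda$ at infinity that vanish at one of the two points of $\Gamma_R$ over $\lambda=\alpha_N$. -/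

import Mathlib

noncomputable section

namespace AlphaFraction

open scoped Polynomial

/-! ### Admissible polynomials and triples -/

/-- The polynomial `∏ (λ - α_i)`, for `N = 2g+1` parameters `α_1, …, α_N`. -/
def frakA {g : ℕ} (α : Fin (2 * g + 1) → ℂ) : ℂ[X] :=
  ∏ i, (Polynomial.X - Polynomial.C (α i))

/-- `R = S² + ∏ (λ - α_i)` for some polynomial `S` of degree at most `g`. -/
def IsAdmissible {g : ℕ} (α : Fin (2 * g + 1) → ℂ) (R : ℂ[X]) : Prop :=
  ∃ S : ℂ[X], S.natDegree ≤ g ∧ R = S ^ 2 + frakA α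

/-- A triple of polynomials `(A, B, C)`, the coefficients of `A φ² + 2 B φ + C = 0`. -/
@[ext]
structure Triple where
  A : ℂ[X]
  B : ℂ[X]
  C : ℂ[X]

/-- The discriminant `B² - AC`. -/
def Triple.disc (T : Triple) : ℂ[X] := T.B ^ 2 - T.A * T.C

/-- `α`-triples: `A` is monic of degree `g`, `C` is anti-monic of degree `g+1`, `deg B ≤ g`,
and the discriminant is `α`-admissible. -/
structure IsAlphaTriple {g : ℕ} (α : Fin (2 * g + 1) → ℂ) (T : Triple) : Prop where
  monic_A : T.A.Monic
  natDegree_A : T.A.natDegree = g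
  antimonic_C : T.C.leadingCoeff = -1
  natDegree_C : T.C.natDegree = g + 1
  natDegree_B : T.B.natDegree ≤ g
  admissible : IsAdmissible α T.disc

/-- The set `M_R^α` of `α`-triples with discriminant `R`. -/
def tripleVariety {g : ℕ} (α : Fin (2 * g + 1) → ℂ) (R : ℂ[X]) : Set Triple :=
  {T | IsAlphaTriple α T ∧ T.disc = R}

/-- The last parameter `α_N`. -/
def lastParam {g : ℕ} (α : Fin (2 * g + 1) → ℂ) : ℂ := α (Fin.last (2 * g))

/-- The subset `P_R^α` of `M_R^α` given by `C(α_N) = 0`. -/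
def pureTripleVariety {g : ℕ} (α : Fin (2 * g + 1) → ℂ) (R : ℂ[X]) : Set Triple :=
  {T | T ∈ tripleVariety α R ∧ T.C.eval (lastParam α) = 0}

/-! ### The hyperelliptic curve and its function field -/

/-- Points of the affine curve `μ² = R(λ)`, as pairs `(λ, μ)`. -/
def AffPoint (R : ℂ[X]) : Type := {P : ℂ × ℂ // P.2 ^ 2 = R.eval P.1}

/-- The hyperelliptic involution `(λ, μ) ↦ (λ, -μ)`. -/
def hyperInv {R : ℂ[X]} (P : AffPoint R) : AffPoint R :=
  ⟨(P.1.1, -P.1.2), by rw [neg_sq]; exact P.2⟩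

/-- Points of the curve `Γ_R`: the affine points and one point at infinity
(`R` is to have odd degree). -/
inductive Point (R : ℂ[X]) : Type
  | aff (P : AffPoint R) : Point R
  | infty : Point R

/-- The algebra `ℂ(λ)[μ]/(μ² - R(λ))` over `ℂ(λ)`. For `R` of odd degree it is the field
`ℂ(λ, √R)` of meromorphic functions on `Γ_R`. -/
abbrev FunField (R : ℂ[X]) : Type :=
  QuadraticAlgebra (RatFunc ℂ) (algebraMap ℂ[X] (RatFunc ℂ) R) 0

/-- The function `μ = √R`. -/
def mu (R : ℂ[X]) : FunField R := QuadraticAlgebra.omega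

/-- A rational function of `λ` as a function on the curve. -/
def ofRat (R : ℂ[X]) (u : RatFunc ℂ) : FunField R := algebraMap (RatFunc ℂ) (FunField R) u

/-- The function `φ = (-B + √R) / A` on `Γ_R`. -/
def Triple.phi (T : Triple) (R : ℂ[X]) : FunField R :=
  ofRat R (algebraMap ℂ[X] (RatFunc ℂ) T.A)⁻¹ *
    (-ofRat R (algebraMap ℂ[X] (RatFunc ℂ) T.B) + mu R)

/-- First affine coordinate `x` of a chart at a point: `λ` at the affine points, `1/λ` at
infinity. -/
def chartX {R : ℂ[X]} : Point R → RatFunc ℂ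
  | .aff _ => RatFunc.X
  | .infty => RatFunc.X⁻¹

/-- Second affine coordinate `y` of a chart at a point of the curve of genus `g`: `μ` at the
affine points, `μ / λ^(g+1)` at infinity. The chart at infinity is the affine curve
`y² = x^(2g+2) R(1/x)`. -/
def chartY (g : ℕ) {R : ℂ[X]} : Point R → FunField R
  | .aff _ => mu R
  | .infty => ofRat R (RatFunc.X⁻¹ ^ (g + 1)) * mu R

/-- The coordinates `(x, y)` of a point in its chart. -/
def center {R : ℂ[X]} : Point R → ℂ × ℂ
  | .aff P => P.1
  | .infty => (0, 0)

/-- The function `p(x) + q(x) y` in the coordinates of the chart at `P`; these are the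
regular functions of the chart. -/
def chartFun (g : ℕ) {R : ℂ[X]} (P : Point R) (p q : ℂ[X]) : FunField R :=
  ofRat R (Polynomial.aeval (chartX P) p) + ofRat R (Polynomial.aeval (chartX P) q) * chartY g P

/-- The value at `P` of `p(x) + q(x) y`. -/
def chartVal {R : ℂ[X]} (P : Point R) (p q : ℂ[X]) : ℂ :=
  p.eval (center P).1 + q.eval (center P).1 * (center P).2

/-- `f` is regular at `P`, with value `c` there: it is a quotient of two regular functions of
the chart whose denominator does not vanish at `P`. -/
def HasValueAt (g : ℕ) {R : ℂ[X]} (f : FunField R) (P : Point R) (c : ℂ) : Prop :=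
  ∃ p q r s : ℂ[X], chartVal P r s ≠ 0 ∧
    f * chartFun g P r s = chartFun g P p q ∧ chartVal P p q = c * chartVal P r s

/-- `f` belongs to the local ring of the curve at `P`. -/
def IsRegularAt (g : ℕ) {R : ℂ[X]} (f : FunField R) (P : Point R) : Prop :=
  ∃ c, HasValueAt g f P c

open Classical in
/-- A local parameter at `P` (for `R` with simple roots): `y` if `P` is a branch point (`P_∞`
included), and `x - x(P)` otherwise. -/
def localParam (g : ℕ) {R : ℂ[X]} (P : Point R) : FunField R :=
  if (center P).2 = 0 then chartY g P
  else ofRat R (chartX P - RatFunc.C (center P).1)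

/-- `f` has at `P` a pole of order at most `n` (`n = 0`: it is regular). -/
def PoleOrderLE (g : ℕ) {R : ℂ[X]} (f : FunField R) (P : Point R) (n : ℕ) : Prop :=
  IsRegularAt g (localParam g P ^ n * f) P

open Classical in
/-- The space `L(E)` of meromorphic functions whose poles are bounded by the positive divisor
`E` (a formal sum of points, given as a multiset). -/
def LSpace (g : ℕ) {R : ℂ[X]} (E : Multiset (Point R)) : Set (FunField R) :=
  {f | ∀ P, PoleOrderLE g f P (E.count P)}

open Classical in
/-- The divisor of poles of `f`, with multiplicities, is exactly `E`. -/
def HasPoleDivisor (g : ℕ) {R : ℂ[X]} (f : FunField R) (E : Multiset (Point R)) : Prop :=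
  ∀ P, IsLeast {n : ℕ | PoleOrderLE g f P n} (E.count P)

/-- `f ∼ √λ` at infinity, for the branch of `√λ` near `P_∞` with `μ ∼ λ^g √λ`. The local
parameter `μ / λ^(g+1)` at `P_∞` is equivalent to `1 / √λ`, so the condition is that the
product of `f` with it takes the value `1` at `P_∞`. -/
def SimSqrt (g : ℕ) {R : ℂ[X]} (f : FunField R) : Prop :=
  HasValueAt g (localParam g (Point.infty : Point R) * f) Point.infty 1

/-! ### The affine Jacobi variety -/

/-- `D = P_1 + ⋯ + P_g` with affine points satisfying `P_i ≠ τ(P_j)` for `i ≠ j`. -/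
def IsNonSpecial (g : ℕ) {R : ℂ[X]} (D : Multiset (AffPoint R)) : Prop :=
  ∃ P : Fin g → AffPoint R, D = Finset.univ.val.map P ∧ ∀ i j, i ≠ j → P i ≠ hyperInv (P j)

/-- The affine Jacobi variety: the non-special positive divisors of degree `g` on the affine
curve. -/
def AffJac (g : ℕ) (R : ℂ[X]) : Type := {D : Multiset (AffPoint R) // IsNonSpecial g D}

/-- The divisor `D + P_∞`. -/
def AffJac.addInfty {g : ℕ} {R : ℂ[X]} (D : AffJac g R) : Multiset (Point R) :=
  Point.infty ::ₘ D.1.map Point.aff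

end AlphaFraction

end

open AlphaFraction

noncomputable section

namespace AlphaFraction

open Polynomial

/-! ### Functions on the curve and their values -/

section Values

variable {g : ℕ} {R : ℂ[X]}

/-! Since `B² - AC = R`, one has `(μ - B)(μ + B) = -AC`, so `φ = (μ - B)/A = -C/(μ + B)`. The second
form shows that `φ` is regular on the affine curve away from the points with `μ = -B(λ)`. At such a
point over a root `a` of `A`, either `μ - B = 2μ ≠ 0` and the pole order is the multiplicity of `a`,
or the point is a branch point and squarefreeness of `R` makes `a` a simple root
(`rootMultiplicity_le_one`). This gives the pole divisor (`IsDivisorOf.hasPoleDivisor`).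

The divisor determines `A`. Replacing `B` by `B + cA` replaces `φ` by `φ - c`, keeps the divisor and
adds `c` to `β`; `eq_of_isDivisorOf` shows that divisor and `β` leave no further freedom. Existence
is interpolation, adding the points of `D` one at a time (`exists_isDivisorOf_interpolation`).

Conversely, for `f` in `L(D + P_∞)` the product `A f` has no affine poles, so it is `p + qμ` with
polynomials `p, q` (`exists_eq_polyFun_add_polyFun_mul_mu`). The behaviour at infinity forces `q =
1` and `deg p ≤ g`; put `B = -p`. Regularity of `f` at the conjugates of the points of `D` then
yields `A ∣ B² - R`, hence a triple (`exists_triple_of_poleOrderLE`).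

In the pure case, `C(α_N) = 0` becomes a quadratic equation for the shift `c`, with leading
coefficient `A(α_N)` and discriminant `4R(α_N) ≠ 0`. It has two solutions, or one if `A(α_N) = 0`.
-/

theorem ofRat_add (u v : RatFunc ℂ) : ofRat R (u + v) = ofRat R u + ofRat R v := map_add _ _ _

theorem ofRat_mul (u v : RatFunc ℂ) : ofRat R (u * v) = ofRat R u * ofRat R v := map_mul _ _ _

theorem ofRat_pow (u : RatFunc ℂ) (n : ℕ) : ofRat R (u ^ n) = ofRat R u ^ n := map_pow _ _ _

theorem ofRat_zero : ofRat R 0 = 0 := map_zero _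

theorem ofRat_one : ofRat R 1 = 1 := map_one _

theorem ofRat_injective : Function.Injective (ofRat R) :=
  QuadraticAlgebra.algebraMap_injective

theorem mu_mul_mu : mu R * mu R = ofRat R (algebraMap ℂ[X] (RatFunc ℂ) R) := by
  simp [mu, ofRat, QuadraticAlgebra.omega_mul_omega_eq_algebraMap]

theorem ofRat_add_ofRat_mul_mu_re (u v : RatFunc ℂ) : (ofRat R u + ofRat R v * mu R).re = u := by
  simp [ofRat, mu]

theorem ofRat_add_ofRat_mul_mu_im (u v : RatFunc ℂ) : (ofRat R u + ofRat R v * mu R).im = v := by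
  simp [ofRat, mu]

theorem eq_ofRat_add_ofRat_mul_mu (f : FunField R) : f = ofRat R f.re + ofRat R f.im * mu R := by
  ext
  · rw [ofRat_add_ofRat_mul_mu_re]
  · rw [ofRat_add_ofRat_mul_mu_im]

theorem star_ofRat (u : RatFunc ℂ) : star (ofRat R u) = ofRat R u := by
  ext <;> simp [ofRat]

theorem star_mu : star (mu R) = -mu R := by
  ext <;> simp [mu]

/-- A polynomial in `λ` as a function on the curve. -/
def polyFun (R : ℂ[X]) : ℂ[X] →+* FunField R :=
  (algebraMap (RatFunc ℂ) (FunField R)).comp (algebraMap ℂ[X] (RatFunc ℂ))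

theorem ofRat_algebraMap (p : ℂ[X]) : ofRat R (algebraMap ℂ[X] (RatFunc ℂ) p) = polyFun R p := rfl

theorem polyFun_injective : Function.Injective (polyFun R) :=
  ofRat_injective.comp (RatFunc.algebraMap_injective ℂ)

theorem polyFun_mul_ofRat_inv {p : ℂ[X]} (hp : p ≠ 0) :
    polyFun R p * ofRat R (algebraMap ℂ[X] (RatFunc ℂ) p)⁻¹ = 1 := by
  rw [← ofRat_algebraMap, ← ofRat_mul, mul_inv_cancel₀ (RatFunc.algebraMap_ne_zero hp), ofRat_one]

theorem polyFun_mul_cancel {p : ℂ[X]} (hp : p ≠ 0) {f f' : FunField R}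
    (h : polyFun R p * f = polyFun R p * f') : f = f' := by
  have := congrArg (ofRat R (algebraMap ℂ[X] (RatFunc ℂ) p)⁻¹ * ·) h
  simpa [← mul_assoc, mul_comm _ (polyFun R p), polyFun_mul_ofRat_inv hp] using this

theorem mu_sq : mu R ^ 2 = polyFun R R := by rw [sq, mu_mul_mu, ofRat_algebraMap]

theorem star_polyFun (p : ℂ[X]) : star (polyFun R p) = polyFun R p := star_ofRat _

/-- The polynomial `h` such that the chart at `P` is the affine curve `y² = h(x)`. -/
def chartPoly (g : ℕ) {R : ℂ[X]} : Point R → ℂ[X]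
  | .aff _ => R
  | .infty => R.reflect (2 * g + 2)

theorem transcendental_chartX (P : Point R) : Transcendental ℂ (chartX P) := by
  cases P with
  | aff P => exact RatFunc.transcendental_X
  | infty =>
    intro h
    exact RatFunc.transcendental_X (by simpa [chartX] using h.inv)

/-- Reflecting the coefficients turns `p` into `x^N p(1/x)`; this is the passage to the chart at
infinity. -/
theorem aeval_X_inv_reflect {p : ℂ[X]} {N : ℕ} (hp : p.natDegree ≤ N) :
    aeval (RatFunc.X⁻¹ : RatFunc ℂ) (p.reflect N) =
      RatFunc.X⁻¹ ^ N * algebraMap ℂ[X] (RatFunc ℂ) p := by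
  let _ : Invertible (RatFunc.X : RatFunc ℂ) := invertibleOfNonzero RatFunc.X_ne_zero
  have h := eval₂_reflect_mul_pow (algebraMap ℂ (RatFunc ℂ)) RatFunc.X N p hp
  rw [invOf_eq_inv] at h
  rw [aeval_def, ← RatFunc.aeval_X_left_eq_algebraMap, aeval_def, ← h, inv_pow]
  field_simp [RatFunc.X_ne_zero]

theorem chartY_sq (hR : R.natDegree = 2 * g + 1) (P : Point R) :
    chartY g P ^ 2 = ofRat R (aeval (chartX P) (chartPoly g P)) := by
  cases P with
  | aff P => rw [chartY, mu_sq, chartX, chartPoly, RatFunc.aeval_X_left_eq_algebraMap]; rfl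
  | infty =>
    rw [chartY, mul_pow, mu_sq, chartX, chartPoly, aeval_X_inv_reflect (by omega), ofRat_mul,
      ← ofRat_pow, ← pow_mul, ofRat_algebraMap]
    ring_nf

theorem center_sq (hR : R.natDegree = 2 * g + 1) (P : Point R) :
    (center P).2 ^ 2 = (chartPoly g P).eval (center P).1 := by
  cases P with
  | aff P => exact P.2
  | infty =>
    simp only [center, chartPoly]
    -- The constant coefficient of the reflection is that of `λ^(2g+2)` in `R`, which is zero:
    -- infinity is a branch point.
    rw [← coeff_zero_eq_eval_zero, coeff_reflect, revAt_zero, coeff_eq_zero_of_natDegree_lt (by omega)]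
    simp

theorem chartFun_mul (hR : R.natDegree = 2 * g + 1) (P : Point R) (p q p' q' : ℂ[X]) :
    chartFun g P p q * chartFun g P p' q' =
      chartFun g P (p * p' + q * q' * chartPoly g P) (p * q' + q * p') := by
  simp only [chartFun, map_add, map_mul, ofRat_add, ofRat_mul]
  linear_combination ofRat R (aeval (chartX P) q) * ofRat R (aeval (chartX P) q') * chartY_sq hR P

theorem chartVal_mul (hR : R.natDegree = 2 * g + 1) (P : Point R) (p q p' q' : ℂ[X]) :
    chartVal P p q * chartVal P p' q' =
      chartVal P (p * p' + q * q' * chartPoly g P) (p * q' + q * p') := by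
  simp only [chartVal, eval_add, eval_mul]
  linear_combination eval (center P).1 q * eval (center P).1 q' * center_sq hR P

theorem chartFun_add (P : Point R) (p q p' q' : ℂ[X]) :
    chartFun g P p q + chartFun g P p' q' = chartFun g P (p + p') (q + q') := by
  simp only [chartFun, map_add, ofRat_add]
  ring

theorem chartVal_add (P : Point R) (p q p' q' : ℂ[X]) :
    chartVal P p q + chartVal P p' q' = chartVal P (p + p') (q + q') := by
  simp only [chartVal, eval_add]
  ring

/-- The coordinate `x` is transcendental over `ℂ`, and `1, μ` are independent over `ℂ(λ)`. Values of
chart functions are therefore well defined. -/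
theorem chartFun_inj {P : Point R} {p q p' q' : ℂ[X]}
    (h : chartFun g P p q = chartFun g P p' q') : p = p' ∧ q = q' := by
  have hinj := transcendental_iff_injective.mp (transcendental_chartX P)
  cases P with
  | aff P =>
    have h1 := congrArg QuadraticAlgebra.re h
    have h2 := congrArg QuadraticAlgebra.im h
    simp only [chartFun, chartY, ofRat_add_ofRat_mul_mu_re, ofRat_add_ofRat_mul_mu_im] at h1 h2
    exact ⟨hinj h1, hinj h2⟩
  | infty =>
    have h1 := congrArg QuadraticAlgebra.re h
    have h2 := congrArg QuadraticAlgebra.im h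
    simp only [chartFun, chartY, ← mul_assoc, ← ofRat_mul, ofRat_add_ofRat_mul_mu_re,
      ofRat_add_ofRat_mul_mu_im] at h1 h2
    exact ⟨hinj h1, hinj (mul_right_cancel₀
      (pow_ne_zero _ (inv_ne_zero RatFunc.X_ne_zero)) h2)⟩

/-- `F` is a regular function of the chart at `P`, with value `v` at `P`. -/
def ChartRegular (g : ℕ) {R : ℂ[X]} (P : Point R) (F : FunField R) (v : ℂ) : Prop :=
  ∃ p q : ℂ[X], chartFun g P p q = F ∧ chartVal P p q = v

theorem ChartRegular.mul (hR : R.natDegree = 2 * g + 1) {P : Point R} {F F' : FunField R}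
    {v v' : ℂ} (h : ChartRegular g P F v) (h' : ChartRegular g P F' v') :
    ChartRegular g P (F * F') (v * v') := by
  obtain ⟨p, q, rfl, rfl⟩ := h
  obtain ⟨p', q', rfl, rfl⟩ := h'
  exact ⟨_, _, (chartFun_mul hR _ _ _ _ _).symm, (chartVal_mul hR _ _ _ _ _).symm⟩

theorem ChartRegular.add {P : Point R} {F F' : FunField R}
    {v v' : ℂ} (h : ChartRegular g P F v) (h' : ChartRegular g P F' v') :
    ChartRegular g P (F + F') (v + v') := by
  obtain ⟨p, q, rfl, rfl⟩ := h
  obtain ⟨p', q', rfl, rfl⟩ := h'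
  exact ⟨_, _, (chartFun_add _ _ _ _ _).symm, (chartVal_add _ _ _ _ _).symm⟩

theorem ChartRegular.unique {P : Point R} {F : FunField R} {v v' : ℂ}
    (h : ChartRegular g P F v) (h' : ChartRegular g P F v') : v = v' := by
  obtain ⟨p, q, rfl, rfl⟩ := h
  obtain ⟨p', q', h, rfl⟩ := h'
  obtain ⟨rfl, rfl⟩ := chartFun_inj h
  rfl

theorem hasValueAt_iff {f : FunField R} {P : Point R} {c : ℂ} :
    HasValueAt g f P c ↔ ∃ (d : FunField R) (v : ℂ),
      ChartRegular g P d v ∧ v ≠ 0 ∧ ChartRegular g P (f * d) (c * v) := by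
  constructor
  · rintro ⟨p, q, r, s, h0, h1, h2⟩
    exact ⟨_, _, ⟨r, s, rfl, rfl⟩, h0, p, q, h1.symm, h2⟩
  · rintro ⟨_, _, ⟨r, s, rfl, rfl⟩, h0, p, q, h1, h2⟩
    exact ⟨p, q, r, s, h0, h1.symm, h2⟩

theorem hasValueAt_chartFun (P : Point R) (p q : ℂ[X]) :
    HasValueAt g (chartFun g P p q) P (chartVal P p q) :=
  ⟨p, q, 1, 0, by simp [chartVal], by simp [chartFun, ofRat_one, ofRat_zero], by simp [chartVal]⟩

theorem hasValueAt_const (P : Point R) (c : ℂ) : HasValueAt g (polyFun R (C c)) P c := by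
  have := hasValueAt_chartFun (g := g) P (C c) 0
  simpa [chartVal, chartFun, ofRat_zero, ofRat_algebraMap, ← ofRat_algebraMap (C c),
    RatFunc.algebraMap_C] using this

namespace HasValueAt

variable {f f' : FunField R} {P : Point R} {c c' : ℂ}

/-- Two fractions are compared by cross-multiplication. This uniqueness stands in for valuations:
lower bounds on pole orders below come from computing one value in two ways. -/
theorem unique (hR : R.natDegree = 2 * g + 1) (h : HasValueAt g f P c)
    (h' : HasValueAt g f P c') : c = c' := by
  obtain ⟨d, v, h0, h1, h2⟩ := hasValueAt_iff.mp h
  obtain ⟨d', v', h0', h1', h2'⟩ := hasValueAt_iff.mp h'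
  have e := (h2.mul hR h0').unique (v' := c' * v' * v)
    (by convert h2'.mul hR h0 using 1; ring)
  apply mul_right_cancel₀ (mul_ne_zero h1 h1')
  linear_combination e

theorem add (hR : R.natDegree = 2 * g + 1) (h : HasValueAt g f P c) (h' : HasValueAt g f' P c') :
    HasValueAt g (f + f') P (c + c') := by
  obtain ⟨d, v, h0, h1, h2⟩ := hasValueAt_iff.mp h
  obtain ⟨d', v', h0', h1', h2'⟩ := hasValueAt_iff.mp h'
  refine hasValueAt_iff.mpr ⟨_, _, h0.mul hR h0', mul_ne_zero h1 h1', ?_⟩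
  convert (h2.mul hR h0').add (h2'.mul hR h0) using 1 <;> ring

theorem mul (hR : R.natDegree = 2 * g + 1) (h : HasValueAt g f P c) (h' : HasValueAt g f' P c') :
    HasValueAt g (f * f') P (c * c') := by
  obtain ⟨d, v, h0, h1, h2⟩ := hasValueAt_iff.mp h
  obtain ⟨d', v', h0', h1', h2'⟩ := hasValueAt_iff.mp h'
  refine hasValueAt_iff.mpr ⟨_, _, h0.mul hR h0', mul_ne_zero h1 h1', ?_⟩
  convert h2.mul hR h2' using 1 <;> ring

theorem neg (hR : R.natDegree = 2 * g + 1) (h : HasValueAt g f P c) :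
    HasValueAt g (-f) P (-c) := by
  simpa using (hasValueAt_const P (-1)).mul hR h

theorem sub (hR : R.natDegree = 2 * g + 1) (h : HasValueAt g f P c) (h' : HasValueAt g f' P c') :
    HasValueAt g (f - f') P (c - c') := by
  simpa [sub_eq_add_neg] using h.add hR (h'.neg hR)

theorem of_mul (hR : R.natDegree = 2 * g + 1) {d : FunField R} (hc : c ≠ 0)
    (hd : HasValueAt g d P c) (hn : HasValueAt g (f * d) P c') : HasValueAt g f P (c' / c) := by
  obtain ⟨e, v, h0, h1, h2⟩ := hasValueAt_iff.mp hd
  obtain ⟨e', v', h0', h1', h2'⟩ := hasValueAt_iff.mp hn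
  refine hasValueAt_iff.mpr ⟨_, _, h2.mul hR h0', mul_ne_zero (mul_ne_zero hc h1) h1', ?_⟩
  convert h2'.mul hR h0 using 1
  · ring
  · field_simp

theorem isRegularAt (h : HasValueAt g f P c) : IsRegularAt g f P := ⟨c, h⟩

end HasValueAt

theorem IsRegularAt.mul (hR : R.natDegree = 2 * g + 1) {f f' : FunField R} {P : Point R}
    (h : IsRegularAt g f P) (h' : IsRegularAt g f' P) : IsRegularAt g (f * f') P :=
  h.elim fun _ h => h'.elim fun _ h' => ⟨_, h.mul hR h'⟩

theorem IsRegularAt.add (hR : R.natDegree = 2 * g + 1) {f f' : FunField R} {P : Point R}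
    (h : IsRegularAt g f P) (h' : IsRegularAt g f' P) : IsRegularAt g (f + f') P :=
  h.elim fun _ h => h'.elim fun _ h' => ⟨_, h.add hR h'⟩

theorem IsRegularAt.of_mul (hR : R.natDegree = 2 * g + 1) {f d : FunField R} {P : Point R} {c : ℂ}
    (hc : c ≠ 0) (hd : HasValueAt g d P c) (h : IsRegularAt g (f * d) P) : IsRegularAt g f P :=
  h.elim fun _ h => ⟨_, hd.of_mul hR hc h⟩

theorem hasValueAt_polyFun (P : AffPoint R) (p : ℂ[X]) :
    HasValueAt g (polyFun R p) (.aff P) (p.eval P.1.1) := by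
  have := hasValueAt_chartFun (g := g) (.aff P) p 0
  simpa [chartVal, chartFun, ofRat_zero, ofRat_algebraMap, chartX, center,
    RatFunc.aeval_X_left_eq_algebraMap] using this

theorem hasValueAt_mu (P : AffPoint R) : HasValueAt g (mu R) (.aff P) P.1.2 := by
  have := hasValueAt_chartFun (g := g) (.aff P) 0 1
  simpa [chartVal, chartFun, ofRat_zero, ofRat_one, center, chartY] using this

/-- The involution `τ` on functions. -/
theorem HasValueAt.star {f : FunField R} {P : AffPoint R} {c : ℂ}
    (h : HasValueAt g f (.aff P) c) : HasValueAt g (star f) (.aff (hyperInv P)) c := by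
  obtain ⟨p, q, r, s, h0, h1, h2⟩ := h
  refine ⟨p, -q, r, -s, ?_, ?_, ?_⟩
  · simpa [chartVal, center, hyperInv] using h0
  · have := congrArg Star.star h1
    simp only [chartFun, star_mul', star_add, star_ofRat, chartY, star_mu] at this
    have hneg : ∀ u, ofRat R (-u) = -ofRat R u := map_neg _
    simpa only [chartFun, chartY, chartX, map_neg, hneg, mul_neg, neg_mul] using this
  · simpa [chartVal, center, hyperInv] using h2

/-- If the denominator vanished, so would the numerator `u · denom`, against coprimality. -/
theorem IsRegularAt.denom_eval_ne_zero (hR : R.natDegree = 2 * g + 1) {u : RatFunc ℂ}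
    {P : AffPoint R} (h : IsRegularAt g (ofRat R u) (.aff P)) : u.denom.eval P.1.1 ≠ 0 := by
  obtain ⟨c, h⟩ := h
  intro h0
  have h1 := h.mul hR (hasValueAt_polyFun P u.denom)
  have e : ofRat R u * polyFun R u.denom = polyFun R u.num := by
    rw [← ofRat_algebraMap, ← ofRat_mul, ← ofRat_algebraMap]
    congr 1
    nth_rw 1 [← RatFunc.num_div_denom u]
    rw [div_mul_cancel₀ _ (RatFunc.algebraMap_ne_zero u.denom_ne_zero)]
  rw [e, h0, mul_zero] at h1
  have h2 := h1.unique hR (hasValueAt_polyFun P u.num)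
  obtain ⟨a, b, hab⟩ := u.isCoprime_num_denom
  have := congrArg (eval P.1.1) hab
  simp [← h2, h0] at this

end Values

/-! ### The point at infinity -/

section Infinity

variable {g : ℕ} {R : ℂ[X]}

theorem localParam_infty : localParam g (Point.infty : Point R) = chartY g (Point.infty : Point R) := by
  simp [localParam, center]

theorem hasValueAt_infty_chartY :
    HasValueAt g (chartY g (Point.infty : Point R)) Point.infty 0 := by
  have := hasValueAt_chartFun (g := g) (Point.infty : Point R) 0 1
  simpa [chartVal, chartFun, ofRat_zero, ofRat_one, center] using this

theorem hasValueAt_infty_polyFun {p : ℂ[X]} {N : ℕ} (hp : p.natDegree ≤ N) :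
    HasValueAt g (ofRat R (RatFunc.X⁻¹ ^ N) * polyFun R p) Point.infty (p.coeff N) := by
  have := hasValueAt_chartFun (g := g) (Point.infty : Point R) (p.reflect N) 0
  simpa [chartVal, chartFun, ofRat_zero, center, chartX, aeval_X_inv_reflect hp, ofRat_mul,
    ofRat_algebraMap, ← coeff_zero_eq_eval_zero, coeff_reflect] using this

/-- Were the degree larger, a further positive power of `1/λ`, which vanishes at infinity, would
give a function whose value is the leading coefficient, forcing that to be zero. -/
theorem natDegree_le_of_hasValueAt_infty (hR : R.natDegree = 2 * g + 1) {p : ℂ[X]} {N : ℕ} {c : ℂ}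
    (h : HasValueAt g (ofRat R (RatFunc.X⁻¹ ^ N) * polyFun R p) Point.infty c) :
    p.natDegree ≤ N := by
  by_contra! hlt
  obtain ⟨k, hk⟩ := Nat.exists_eq_add_of_lt hlt
  have h1 : HasValueAt g (ofRat R (RatFunc.X⁻¹ ^ (k + 1))) (Point.infty : Point R) 0 := by
    simpa [coeff_one] using
      hasValueAt_infty_polyFun (g := g) (R := R) (p := 1) (N := k + 1) (by simp)
  have h2 := h1.mul hR h
  rw [← mul_assoc, ← ofRat_mul, ← pow_add, show k + 1 + N = p.natDegree by omega] at h2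
  have h3 := h2.unique hR (hasValueAt_infty_polyFun le_rfl)
  rw [zero_mul, coeff_natDegree, eq_comm, leadingCoeff_eq_zero] at h3
  simp [h3] at hlt

/-- The involution fixes `P_∞`, so the value does not change. -/
theorem HasValueAt.star_infty {f : FunField R} {c : ℂ}
    (h : HasValueAt g f Point.infty c) : HasValueAt g (Star.star f) Point.infty c := by
  obtain ⟨p, q, r, s, h0, h1, h2⟩ := h
  refine ⟨p, -q, r, -s, ?_, ?_, ?_⟩
  · simpa [chartVal, center] using h0
  · have := congrArg Star.star h1
    simp only [chartFun, star_mul', star_add, star_ofRat, chartY, star_mu] at this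
    have hneg : ∀ u, ofRat R (-u) = -ofRat R u := map_neg _
    simpa only [chartFun, chartY, chartX, map_neg, hneg, mul_neg, neg_mul] using this
  · simpa [chartVal, center] using h2

theorem SimSqrt.isLeast_poleOrderLE (hR : R.natDegree = 2 * g + 1) {f : FunField R}
    (h : SimSqrt g f) : IsLeast {n | PoleOrderLE g f Point.infty n} 1 := by
  refine ⟨by simpa [PoleOrderLE] using h.isRegularAt, fun n hn => ?_⟩
  by_contra! h0
  obtain rfl : n = 0 := by omega
  obtain ⟨c, hc⟩ := hn
  rw [pow_zero, one_mul] at hc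
  have h1 := (hasValueAt_infty_chartY.mul hR hc).unique hR (by rwa [SimSqrt, localParam_infty] at h)
  simp at h1

end Infinity

/-! ### The discriminant -/

section Discriminant

variable {g : ℕ} {R : ℂ[X]} {α : Fin (2 * g + 1) → ℂ}

theorem IsAdmissible.monic_and_natDegree (h : IsAdmissible α R) :
    R.Monic ∧ R.natDegree = 2 * g + 1 := by
  obtain ⟨S, hS, rfl⟩ := h
  have h1 : (frakA α).Monic := monic_prod_of_monic _ _ fun i _ => monic_X_sub_C _
  have h2 : (frakA α).natDegree = 2 * g + 1 := by
    rw [frakA, natDegree_prod_of_monic _ _ fun i _ => monic_X_sub_C _]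
    simp
  have h3 : (S ^ 2).degree < (frakA α).degree := by
    rw [degree_eq_natDegree h1.ne_zero, h2]
    refine lt_of_le_of_lt degree_le_natDegree ?_
    have := natDegree_pow_le (p := S) (n := 2)
    exact_mod_cast (by omega : (S ^ 2).natDegree < 2 * g + 1)
  exact ⟨h1.add_of_right h3, by rw [natDegree_add_eq_right_of_degree_lt h3, h2]⟩

theorem squarefree_of_nodup_roots (hR : R ≠ 0) (h : R.roots.Nodup) : Squarefree R :=
  (Polynomial.Separable.squarefree
    ((nodup_roots_iff_of_splits hR (IsAlgClosed.splits R)).mp h))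

theorem eval_ne_zero_of_squarefree (h : Squarefree R) {a : ℂ} {p : ℂ[X]}
    (hp : R = (X - C a) * p) : p.eval a ≠ 0 := by
  intro h0
  obtain ⟨q, rfl⟩ := dvd_iff_isRoot.mpr h0
  have := h (X - C a) ⟨q, by rw [hp]; ring⟩
  exact not_isUnit_X_sub_C a this

end Discriminant

/-! ### The function of a triple -/

section Phi

variable {g : ℕ} {R : ℂ[X]} {T : Triple}

theorem polyFun_A_mul_phi (hA : T.A ≠ 0) :
    polyFun R T.A * T.phi R = mu R - polyFun R T.B := by
  rw [Triple.phi, ← mul_assoc, polyFun_mul_ofRat_inv hA, one_mul, ofRat_algebraMap]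
  ring

/-- The conjugate form of `φ`, usable where `A` vanishes but `μ + B` does not. -/
theorem phi_mul_mu_add (hA : T.A ≠ 0) (hT : T.disc = R) :
    T.phi R * (mu R + polyFun R T.B) = polyFun R (-T.C) := by
  apply polyFun_mul_cancel hA
  rw [← mul_assoc, polyFun_A_mul_phi hA, ← map_mul, ← sub_eq_zero]
  have h : polyFun R R = polyFun R (T.B ^ 2 - T.A * T.C) := by rw [← hT]; rfl
  rw [map_sub, map_pow, ← mu_sq] at h
  rw [mul_neg, map_neg]
  linear_combination h

/-- The coordinates of `φ` in the basis `1, μ` are `-B/A` and `1/A`; the discriminant then gives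
`C`. -/
theorem phi_injective {T T' : Triple} (hA : T.A ≠ 0) (hT : T.disc = R)
    (hT' : T'.disc = R) (h : T.phi R = T'.phi R) : T = T' := by
  have him := congrArg QuadraticAlgebra.im h
  have hre := congrArg QuadraticAlgebra.re h
  simp only [Triple.phi, mul_add, mul_neg, ← ofRat_mul] at him hre
  have hneg : ∀ u, -ofRat R u = ofRat R (-u) := fun u => (map_neg _ u).symm
  rw [hneg, hneg, ofRat_add_ofRat_mul_mu_re, ofRat_add_ofRat_mul_mu_re] at hre
  rw [hneg, hneg, ofRat_add_ofRat_mul_mu_im, ofRat_add_ofRat_mul_mu_im] at him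
  rw [← him] at hre
  have eA : T.A = T'.A := RatFunc.algebraMap_injective ℂ (inv_injective him)
  have eB : T.B = T'.B := RatFunc.algebraMap_injective ℂ
    (mul_left_cancel₀ (inv_ne_zero (RatFunc.algebraMap_ne_zero hA)) (neg_injective hre))
  have eC : T.C = T'.C := by
    apply mul_left_cancel₀ hA
    have := hT.trans hT'.symm
    rw [Triple.disc, Triple.disc, ← eA, ← eB] at this
    linear_combination -this
  exact Triple.ext eA eB eC

/-- With `x = 1/λ` and `y = μ x^(g+1)`, one has `x^g A · yφ = x^(2g+1) R - x^g B · y`. At infinity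
`x^g A` and `x^(2g+1) R` take the value `1` as both polynomials are monic, and `y` vanishes. -/
theorem simSqrt_phi (hdeg : R.natDegree = 2 * g + 1) (hR : R.Monic) (hA : T.A.Monic)
    (hAg : T.A.natDegree = g) (hB : T.B.natDegree ≤ g) : SimSqrt g (T.phi R) := by
  rw [SimSqrt, localParam_infty]
  have h1 := hasValueAt_infty_polyFun (g := g) (R := R) hAg.le
  have h2 := (hasValueAt_infty_polyFun (g := g) (R := R) hdeg.le).sub hdeg
    ((hasValueAt_infty_polyFun (g := g) (R := R) hB).mul hdeg hasValueAt_infty_chartY)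
  have hc : T.A.coeff g = 1 := by rw [← hAg]; exact hA
  have hc' : R.coeff (2 * g + 1) = 1 := by rw [← hdeg]; exact hR
  rw [hc] at h1
  rw [hc', mul_zero, sub_zero] at h2
  have := HasValueAt.of_mul (f := chartY g (Point.infty : Point R) * T.phi R) hdeg one_ne_zero h1
    (c' := 1) ?_
  · simpa using this
  · convert h2 using 1
    have e := polyFun_A_mul_phi (R := R) hA.ne_zero
    have e' : ofRat R (RatFunc.X⁻¹ ^ (2 * g + 1)) =
        ofRat R (RatFunc.X⁻¹ ^ (g + 1)) * ofRat R (RatFunc.X⁻¹ ^ g) := by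
      rw [← ofRat_mul]; ring_nf
    rw [chartY, e', ← mu_sq]
    linear_combination ofRat R (RatFunc.X⁻¹ ^ (g + 1)) * ofRat R (RatFunc.X⁻¹ ^ g) * mu R * e

theorem isLeast_zero_of_isRegularAt {f : FunField R} {P : Point R} (h : IsRegularAt g f P) :
    IsLeast {n | PoleOrderLE g f P n} 0 :=
  ⟨by simpa [PoleOrderLE] using h, fun _ _ => Nat.zero_le _⟩

theorem localParam_aff_of_eq_zero {P : AffPoint R} (h : P.1.2 = 0) :
    localParam g (.aff P) = mu R := by
  simp [localParam, center, h, chartY]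

theorem localParam_aff_of_ne_zero {P : AffPoint R} (h : P.1.2 ≠ 0) :
    localParam g (.aff P) = polyFun R (X - C P.1.1) := by
  simp [localParam, center, h, chartX, ← ofRat_algebraMap, RatFunc.algebraMap_X,
    RatFunc.algebraMap_C]

theorem eq_pow_rootMultiplicity_mul {p : ℂ[X]} (hp : p ≠ 0) (a : ℂ) :
    ∃ q, p = (X - C a) ^ p.rootMultiplicity a * q ∧ q.eval a ≠ 0 := by
  obtain ⟨q, hq, h⟩ := exists_eq_pow_rootMultiplicity_mul_and_not_dvd p hp a
  exact ⟨q, hq, fun h0 => h (dvd_iff_isRoot.mpr h0)⟩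

/-- Otherwise `(λ - a)²` divides both `B²` and `A`, hence `R`. -/
theorem rootMultiplicity_le_one (hsq : Squarefree R) (hT : T.disc = R) (hA : T.A ≠ 0) {a : ℂ}
    (hB : T.B.eval a = 0) : T.A.rootMultiplicity a ≤ 1 := by
  by_contra! h
  obtain ⟨B', hB'⟩ := dvd_iff_isRoot.mpr hB
  obtain ⟨A', hA'⟩ := (le_rootMultiplicity_iff hA).mp h
  refine not_isUnit_X_sub_C a (hsq (X - C a) ⟨B' ^ 2 - A' * T.C, ?_⟩)
  rw [← hT, Triple.disc, hB']
  conv_lhs => rw [hA']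
  ring

theorem isLeast_poleOrderLE_phi (hdeg : R.natDegree = 2 * g + 1) (hsq : Squarefree R)
    (hA : T.A ≠ 0) (hT : T.disc = R) {P : AffPoint R} (hP : P.1.2 = -T.B.eval P.1.1) :
    IsLeast {n | PoleOrderLE g (T.phi R) (.aff P) n} (T.A.rootMultiplicity P.1.1) := by
  obtain ⟨A₁, hA₁, hA₁0⟩ := eq_pow_rootMultiplicity_mul hA P.1.1
  have hphi := polyFun_A_mul_phi (R := R) hA
  have hval := (hasValueAt_mu (g := g) P).sub hdeg (hasValueAt_polyFun P T.B)
  by_cases hm : P.1.2 = 0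
  · have hB0 : T.B.eval P.1.1 = 0 := by rw [hm] at hP; exact neg_eq_zero.mp hP.symm
    have hle := rootMultiplicity_le_one hsq hT hA hB0
    generalize T.A.rootMultiplicity P.1.1 = k at *
    obtain rfl | rfl : k = 0 ∨ k = 1 := by omega
    · apply isLeast_zero_of_isRegularAt
      refine IsRegularAt.of_mul hdeg hA₁0 (hasValueAt_polyFun P A₁) ?_
      · rw [pow_zero, one_mul] at hA₁
        rw [← hA₁, mul_comm, hphi]
        exact hval.isRegularAt
    · obtain ⟨B₁, hB₁⟩ := dvd_iff_isRoot.mpr hB0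
      have hR0 : R.eval P.1.1 = 0 := by rw [← P.2, hm]; simp
      obtain ⟨R₁, hR₁⟩ := dvd_iff_isRoot.mpr hR0
      have hR₁0 := eval_ne_zero_of_squarefree hsq hR₁
      -- This is `μ · Aφ = R - Bμ` divided by `λ - a`; the right side takes the value `R₁(a) ≠ 0` at
      -- the branch point.
      have key : mu R * T.phi R * polyFun R A₁ = polyFun R R₁ - polyFun R B₁ * mu R := by
        apply polyFun_mul_cancel (X_sub_C_ne_zero P.1.1)
        have e1 : polyFun R T.A = polyFun R (X - C P.1.1) * polyFun R A₁ := by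
          rw [← map_mul]; congr 1; rw [pow_one] at hA₁; exact hA₁
        have e2 : polyFun R T.B = polyFun R (X - C P.1.1) * polyFun R B₁ := by
          rw [← map_mul]; congr 1
        have e3 : polyFun R R = polyFun R (X - C P.1.1) * polyFun R R₁ := by
          rw [← map_mul]; congr 1
        rw [← mu_sq] at e3
        rw [e1, e2] at hphi
        linear_combination mu R * hphi + e3
      have hval' := (hasValueAt_polyFun (g := g) P R₁).sub hdeg
        ((hasValueAt_polyFun P B₁).mul hdeg (hasValueAt_mu P))
      rw [hm, mul_zero, sub_zero] at hval'
      constructor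
      · show IsRegularAt _ _ _
        rw [localParam_aff_of_eq_zero hm, pow_one]
        refine IsRegularAt.of_mul hdeg hA₁0 (hasValueAt_polyFun P A₁) ?_
        · rw [key]; exact hval'.isRegularAt
      · intro n hn
        by_contra! h0
        obtain rfl : n = 0 := by omega
        obtain ⟨c, hc⟩ := hn
        rw [pow_zero, one_mul] at hc
        have h1 := ((hasValueAt_mu P).mul hdeg hc).mul hdeg (hasValueAt_polyFun P A₁)
        rw [key] at h1
        have := h1.unique hdeg hval'
        rw [hm, zero_mul, zero_mul] at this
        exact hR₁0 this.symm
  · rw [show P.1.2 - T.B.eval P.1.1 = 2 * P.1.2 by linear_combination -hP] at hval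
    generalize T.A.rootMultiplicity P.1.1 = k at *
    constructor
    · show IsRegularAt _ _ _
      rw [localParam_aff_of_ne_zero hm, ← map_pow]
      refine IsRegularAt.of_mul hdeg hA₁0 (hasValueAt_polyFun P A₁) ?_
      · rw [mul_right_comm, ← map_mul, ← hA₁, hphi]; exact hval.isRegularAt
    · intro n hn
      by_contra! hlt
      obtain ⟨c, hc⟩ := hn
      rw [localParam_aff_of_ne_zero hm, ← map_pow] at hc
      have h1 := hc.mul hdeg (hasValueAt_polyFun P ((X - C P.1.1) ^ (k - n) * A₁))
      have e : polyFun R ((X - C P.1.1) ^ n) * T.phi R *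
          polyFun R ((X - C P.1.1) ^ (k - n) * A₁) = mu R - polyFun R T.B := by
        rw [← hphi, mul_right_comm, ← map_mul, ← mul_assoc, ← pow_add,
          Nat.add_sub_cancel' hlt.le, ← hA₁]
      rw [e] at h1
      have := h1.unique hdeg hval
      rw [eval_mul, eval_pow, eval_sub, eval_X, eval_C, sub_self, zero_pow (by omega)] at this
      simp [hm] at this

theorem isRegularAt_phi (hdeg : R.natDegree = 2 * g + 1) (hA : T.A ≠ 0) (hT : T.disc = R)
    {P : AffPoint R} (hP : P.1.2 ≠ -T.B.eval P.1.1) :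
    IsRegularAt g (T.phi R) (.aff P) := by
  refine IsRegularAt.of_mul hdeg (c := P.1.2 + T.B.eval P.1.1)
    (fun h => hP (by linear_combination h))
    ((hasValueAt_mu P).add hdeg (hasValueAt_polyFun P T.B)) ?_
  · rw [phi_mul_mu_add hA hT]
    exact (hasValueAt_polyFun P _).isRegularAt

theorem exists_hasValueAt_phi_zero_iff (hdeg : R.natDegree = 2 * g + 1) (hA : T.A ≠ 0)
    (hT : T.disc = R) {a : ℂ} (ha : R.eval a ≠ 0) :
    (∃ P : AffPoint R, P.1.1 = a ∧ HasValueAt g (T.phi R) (.aff P) 0) ↔ T.C.eval a = 0 := by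
  have hphi := phi_mul_mu_add hA hT
  constructor
  · rintro ⟨P, rfl, h⟩
    have h1 := h.mul hdeg ((hasValueAt_mu P).add hdeg (hasValueAt_polyFun P T.B))
    rw [hphi] at h1
    have := h1.unique hdeg (hasValueAt_polyFun P _)
    simpa using this.symm
  · intro hC
    have hB : T.B.eval a ^ 2 = R.eval a := by
      rw [← hT, Triple.disc, eval_sub, eval_pow, eval_mul, hC]; ring
    have hB0 : T.B.eval a ≠ 0 := by rintro h; rw [h] at hB; simp at hB; exact ha hB.symm
    -- Of the two points over `a`, this is the one where `μ + B = 2B(a)` does not vanish.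
    let P : AffPoint R := ⟨(a, T.B.eval a), hB⟩
    refine ⟨P, rfl, ?_⟩
    have h1 := HasValueAt.of_mul (f := T.phi R) hdeg (c := T.B.eval a + T.B.eval a) (by simpa using hB0)
      ((hasValueAt_mu P).add hdeg (hasValueAt_polyFun P T.B)) (c' := 0) ?_
    · simpa using h1
    · rw [hphi]
      have := hasValueAt_polyFun (g := g) P (-T.C)
      simpa [P, hC] using this

end Phi

/-! ### Non-special divisors -/

section NonSpecial

variable {g : ℕ} {R : ℂ[X]}

theorem AffPoint.ext {P Q : AffPoint R} (h : P.1 = Q.1) : P = Q := Subtype.ext h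

/-- The coordinates `(λ, μ)` of an affine point. -/
def AffPoint.coord (P : AffPoint R) : ℂ × ℂ := P.1

theorem AffPoint.coord_injective : Function.Injective (AffPoint.coord (R := R)) :=
  fun _ _ h => AffPoint.ext h

theorem hyperInv_hyperInv (P : AffPoint R) : hyperInv (hyperInv P) = P :=
  AffPoint.ext (by simp [hyperInv])

theorem hyperInv_of_eq_zero {P : AffPoint R} (h : P.1.2 = 0) : hyperInv P = P :=
  AffPoint.ext (Prod.ext rfl (by simp [hyperInv, h]))

theorem hyperInv_ne_of_ne_zero {P : AffPoint R} (h : P.1.2 ≠ 0) : hyperInv P ≠ P := by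
  intro h'
  have := congrArg (fun Q : AffPoint R => Q.1.2) h'
  simp only [hyperInv] at this
  exact h (self_eq_neg.mp this.symm)

/-- Symmetry makes the order of the points irrelevant, so the condition for `i ≠ j` can be checked
for `i < j`. -/
instance : Std.Symm fun P Q : AffPoint R => P ≠ hyperInv Q :=
  ⟨fun P Q h h' => h (by rw [h', hyperInv_hyperInv])⟩

theorem isNonSpecial_iff {D : Multiset (AffPoint R)} :
    IsNonSpecial g D ↔ Multiset.card D = g ∧ D.Pairwise fun P Q => P ≠ hyperInv Q := by
  constructor
  · rintro ⟨P, rfl, h⟩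
    refine ⟨by simp, List.ofFn P, ?_, ?_⟩
    · simp [Fin.univ_val_map]
    · rw [List.pairwise_ofFn]
      exact fun i j hij => h i j hij.ne
  · rintro ⟨hc, l, rfl, hl⟩
    rw [Multiset.coe_card] at hc
    subst hc
    refine ⟨l.get, by simp [Fin.univ_val_map], fun i j hij => ?_⟩
    rcases lt_or_gt_of_ne hij with h | h
    · exact List.pairwise_iff_get.mp hl i j h
    · exact symm_of (fun P Q : AffPoint R => P ≠ hyperInv Q) (List.pairwise_iff_get.mp hl j i h)

theorem pairwise_cons_iff {P : AffPoint R} {D : Multiset (AffPoint R)} :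
    (P ::ₘ D).Pairwise (fun P Q => P ≠ hyperInv Q) ↔
      hyperInv P ∉ D ∧ D.Pairwise fun P Q => P ≠ hyperInv Q := by
  induction D using Quotient.inductionOn with
  | _ l =>
    simp only [Multiset.quot_mk_to_coe, Multiset.cons_coe, Multiset.pairwise_coe_iff_pairwise,
      List.pairwise_cons, Multiset.mem_coe]
    refine and_congr_left fun _ => ⟨fun h h' => h _ h' (hyperInv_hyperInv P).symm, fun h Q hQ e => ?_⟩
    rw [e, hyperInv_hyperInv] at h
    exact h hQ

theorem hyperInv_notMem {P : AffPoint R} {D : Multiset (AffPoint R)}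
    (hD : D.Pairwise fun P Q => P ≠ hyperInv Q) (hP : P ∈ D) (h : P.1.2 ≠ 0) :
    hyperInv P ∉ D := by
  obtain ⟨E, rfl⟩ := Multiset.exists_cons_of_mem hP
  rw [Multiset.mem_cons, not_or]
  exact ⟨hyperInv_ne_of_ne_zero h, (pairwise_cons_iff.mp hD).1⟩

theorem pairwise_of_forall_cons {D : Multiset (AffPoint R)}
    (h : ∀ P E, D = P ::ₘ E → hyperInv P ∉ E) : D.Pairwise fun P Q => P ≠ hyperInv Q := by
  induction D using Multiset.induction_on with
  | empty => exact ⟨[], rfl, List.Pairwise.nil⟩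
  | cons P D ih =>
    refine pairwise_cons_iff.mpr ⟨h P D rfl, ih fun Q E hE hQ => ?_⟩
    exact h Q (P ::ₘ E) (by rw [hE, Multiset.cons_swap]) (Multiset.mem_cons_of_mem hQ)

open Classical in
theorem count_le_one {P : AffPoint R} {D : Multiset (AffPoint R)}
    (hD : D.Pairwise fun P Q => P ≠ hyperInv Q) (h : P.1.2 = 0) : D.count P ≤ 1 := by
  by_cases hP : P ∈ D
  · obtain ⟨E, rfl⟩ := Multiset.exists_cons_of_mem hP
    have := (pairwise_cons_iff.mp hD).1
    rw [hyperInv_of_eq_zero h] at this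
    simp [Multiset.count_eq_zero_of_notMem this]
  · simp [Multiset.count_eq_zero_of_notMem hP]

theorem eq_of_mem_of_fst_eq {P Q : AffPoint R} {D : Multiset (AffPoint R)}
    (hD : D.Pairwise fun P Q => P ≠ hyperInv Q) (hP : P ∈ D) (hQ : Q ∈ D) (h : P.1.1 = Q.1.1) :
    P = Q := by
  have h2 : P.1.2 ^ 2 = Q.1.2 ^ 2 := by rw [P.2, Q.2, h]
  rcases sq_eq_sq_iff_eq_or_eq_neg.mp h2 with h3 | h3
  · exact AffPoint.ext (Prod.ext h h3)
  · have e : P = hyperInv Q := AffPoint.ext (Prod.ext h h3)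
    by_cases h0 : Q.1.2 = 0
    · rw [e, hyperInv_of_eq_zero h0]
    · exact absurd (e ▸ hP) (hyperInv_notMem hD hQ h0)

end NonSpecial

/-! ### The divisor of a triple -/

section DivisorOfTriple

variable {g : ℕ} {R : ℂ[X]} {T : Triple} {D : Multiset (AffPoint R)}

/-- `D` is the divisor `∑ (λ_i, -B(λ_i))` over the roots `λ_i` of `A`. -/
def IsDivisorOf (T : Triple) (D : Multiset (AffPoint R)) : Prop :=
  D.map AffPoint.coord = T.A.roots.map fun a => (a, -T.B.eval a)

theorem IsDivisorOf.unique {D' : Multiset (AffPoint R)} (h : IsDivisorOf T D)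
    (h' : IsDivisorOf T D') : D = D' :=
  Multiset.map_injective AffPoint.coord_injective (h.trans h'.symm)

theorem IsDivisorOf.map_fst (h : IsDivisorOf T D) : D.map (fun P => P.1.1) = T.A.roots := by
  have := congrArg (Multiset.map Prod.fst) h
  simpa only [Multiset.map_map, Function.comp_def, AffPoint.coord, Multiset.map_id'] using this

theorem IsDivisorOf.snd_eq (h : IsDivisorOf T D) {P : AffPoint R} (hP : P ∈ D) :
    P.1.2 = -T.B.eval P.1.1 := by
  have := Multiset.mem_map_of_mem AffPoint.coord hP
  rw [h, Multiset.mem_map] at this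
  obtain ⟨a, -, ha⟩ := this
  have h1 : a = P.1.1 := congrArg Prod.fst ha
  have h2 : -T.B.eval a = P.1.2 := congrArg Prod.snd ha
  rw [← h2, h1]

theorem isDivisorOf_of_map_fst (h : D.map (fun P => P.1.1) = T.A.roots)
    (h' : ∀ P ∈ D, P.1.2 = -T.B.eval P.1.1) : IsDivisorOf T D := by
  rw [IsDivisorOf, ← h, Multiset.map_map]
  exact Multiset.map_congr rfl fun P hP => Prod.ext rfl (h' P hP)

open Classical in
theorem IsDivisorOf.count_eq (h : IsDivisorOf T D) (P : AffPoint R) :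
    D.count P = if P.1.2 = -T.B.eval P.1.1 then T.A.rootMultiplicity P.1.1 else 0 := by
  split_ifs with hP
  · rw [← Multiset.count_map_eq_count' _ D AffPoint.coord_injective, h, ← count_roots,
      ← Multiset.count_map_eq_count' (fun a => (a, -T.B.eval a)) T.A.roots
        (fun a b hab => congrArg Prod.fst hab)]
    congr 1
    exact Prod.ext rfl hP
  · exact Multiset.count_eq_zero_of_notMem fun hm => hP (h.snd_eq hm)

theorem IsDivisorOf.hasPoleDivisor (hdeg : R.natDegree = 2 * g + 1) (hsq : Squarefree R)
    (hA : T.A ≠ 0) (hT : T.disc = R) (hs : SimSqrt g (T.phi R)) (h : IsDivisorOf T D) :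
    HasPoleDivisor g (T.phi R) (Point.infty ::ₘ D.map Point.aff) := by
  classical
  have hinj : Function.Injective (Point.aff : AffPoint R → Point R) :=
    fun P Q h => Point.aff.inj h
  intro P
  cases P with
  | infty =>
    convert hs.isLeast_poleOrderLE hdeg
    rw [Multiset.count_cons_self, Multiset.count_eq_zero_of_notMem (by simp)]
  | aff P =>
    have hc : (Point.infty ::ₘ D.map Point.aff).count (Point.aff P) = D.count P := by
      rw [Multiset.count_cons_of_ne (by simp), Multiset.count_map_eq_count' _ _ hinj]
    suffices IsLeast {n | PoleOrderLE g (T.phi R) (.aff P) n} (D.count P) by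
      rw [← hc] at this
      convert this
    rw [h.count_eq]
    split_ifs with hP
    · exact isLeast_poleOrderLE_phi hdeg hsq hA hT hP
    · exact isLeast_zero_of_isRegularAt (isRegularAt_phi hdeg hA hT hP)

/-- If `P` and `τ(P)` both occur, then `B = -B` over that `λ`, so `P` is a branch point counted
twice, while `A` has at most a simple root there. -/
theorem IsDivisorOf.isNonSpecial (hsq : Squarefree R) (hA : T.A ≠ 0) (hT : T.disc = R)
    (hAg : T.A.natDegree = g) (h : IsDivisorOf T D) : IsNonSpecial g D := by
  classical
  rw [isNonSpecial_iff]
  constructor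
  · have := congrArg Multiset.card h.map_fst
    rwa [Multiset.card_map, (splits_iff_card_roots.mp (IsAlgClosed.splits T.A)), hAg] at this
  · refine pairwise_of_forall_cons fun P E hE hP => ?_
    have h1 := h.snd_eq (P := P) (by simp [hE])
    have h2 := h.snd_eq (P := hyperInv P) (by simp [hE, hP])
    have h0 : P.1.2 = 0 := by
      simp only [hyperInv] at h2
      rw [← h1] at h2
      exact neg_eq_self.mp h2
    have h3 := h.count_eq P
    rw [if_pos h1] at h3
    have h4 := rootMultiplicity_le_one hsq hT hA (a := P.1.1)
      (neg_eq_zero.mp (h1.symm.trans h0))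
    rw [hyperInv_of_eq_zero h0] at hP
    have := Multiset.one_le_count_iff_mem.mpr hP
    rw [hE, Multiset.count_cons_self] at h3
    omega

theorem exists_isDivisorOf (hT : T.disc = R) : ∃ D : Multiset (AffPoint R), IsDivisorOf T D := by
  have hmem : ∀ a, T.A.IsRoot a → (-T.B.eval a) ^ 2 = R.eval a := fun a ha => by
    simp [← hT, Triple.disc, IsRoot.def.mp ha]
  let f : ∀ a, T.A.IsRoot a → AffPoint R := fun a ha => ⟨(a, -T.B.eval a), hmem a ha⟩
  refine ⟨T.A.roots.pmap f (fun a ha => (mem_roots'.mp ha).2), ?_⟩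
  · rw [IsDivisorOf, Multiset.map_pmap]
    exact Multiset.pmap_eq_map _ _ _ _

theorem dvd_of_pow_rootMultiplicity_dvd {p q : ℂ[X]} (hp : p ≠ 0)
    (h : ∀ a, p.eval a = 0 → (X - C a) ^ p.rootMultiplicity a ∣ q) : p ∣ q := by
  classical
  by_cases hq : q = 0
  · rw [hq]; exact dvd_zero _
  rw [IsAlgClosed.dvd_iff_roots_le_roots hp hq, Multiset.le_iff_count]
  intro a
  rw [count_roots, count_roots]
  by_cases ha : p.eval a = 0
  · exact (le_rootMultiplicity_iff hq).mpr (h a ha)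
  · rw [rootMultiplicity_eq_zero ha]; exact Nat.zero_le _

theorem isCoprime_X_sub_C_pow {a : ℂ} {q : ℂ[X]} (h : q.eval a ≠ 0) (n : ℕ) :
    IsCoprime ((X - C a) ^ n) q := by
  refine IsCoprime.pow_left ((irreducible_X_sub_C a).coprime_iff_not_dvd.mpr fun h' => h ?_)
  exact dvd_iff_isRoot.mp h'

theorem A_eq_of_isDivisorOf {T' : Triple} (hA : T.A.Monic) (hA' : T'.A.Monic)
    (h : IsDivisorOf T D) (h' : IsDivisorOf T' D) : T.A = T'.A := by
  have e : T.A.roots = T'.A.roots := h.map_fst.symm.trans h'.map_fst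
  rw [(IsAlgClosed.splits T.A).eq_prod_roots_of_monic hA,
    (IsAlgClosed.splits T'.A).eq_prod_roots_of_monic hA', e]

/-- From `(B - B')(B + B') = A(C - C')` one gets `A ∣ B - B'` root by root: where `B(a) ≠ 0` the
factor `B + B'` is a unit at `a`, and where `B(a) = 0` the root is simple. Equality of the
coefficients of degree `deg A` then leaves `B - B' = 0`. -/
theorem eq_of_isDivisorOf {T' : Triple} (hsq : Squarefree R) (hA : T.A.Monic) (hA' : T'.A.Monic)
    (hT : T.disc = R) (hT' : T'.disc = R) (hB : T.B.natDegree ≤ T.A.natDegree)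
    (hB' : T'.B.natDegree ≤ T.A.natDegree) (h : IsDivisorOf T D) (h' : IsDivisorOf T' D)
    (hβ : T.B.coeff T.A.natDegree = T'.B.coeff T.A.natDegree) : T = T' := by
  have eA := A_eq_of_isDivisorOf hA hA' h h'
  have hdisc : (T.B - T'.B) * (T.B + T'.B) = T.A * (T.C - T'.C) := by
    have := hT.trans hT'.symm
    rw [Triple.disc, Triple.disc, ← eA] at this
    linear_combination this
  have hdvd : T.A ∣ T.B - T'.B := by
    refine dvd_of_pow_rootMultiplicity_dvd hA.ne_zero fun a ha => ?_
    have hmem : a ∈ T.A.roots := (mem_roots hA.ne_zero).mpr ha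
    rw [← h.map_fst, Multiset.mem_map] at hmem
    obtain ⟨P, hP, rfl⟩ := hmem
    have e1 := h.snd_eq hP
    have e2 := h'.snd_eq hP
    have e : T.B.eval P.1.1 = T'.B.eval P.1.1 := neg_injective (e1.symm.trans e2)
    by_cases h0 : T.B.eval P.1.1 = 0
    · refine (pow_dvd_pow _ (rootMultiplicity_le_one hsq hT hA.ne_zero h0)).trans ?_
      rw [pow_one, dvd_iff_isRoot]
      simp [e]
    · refine (isCoprime_X_sub_C_pow (q := T.B + T'.B) ?_ _).dvd_of_dvd_mul_right ?_
      · rw [eval_add, ← e, ← two_mul]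
        exact mul_ne_zero two_ne_zero h0
      · rw [hdisc]
        exact (pow_rootMultiplicity_dvd T.A _).mul_right _
  have eB : T.B = T'.B := by
    rw [← sub_eq_zero]
    by_contra hne
    have h1 := natDegree_le_of_dvd hdvd hne
    have h2 : (T.B - T'.B).natDegree ≤ T.A.natDegree := 
      (natDegree_sub_le_of_le hB hB').trans (max_self _).le
    apply hne
    rw [← leadingCoeff_eq_zero, leadingCoeff, le_antisymm h2 h1, coeff_sub, hβ, sub_self]
  refine Triple.ext eA eB (mul_left_cancel₀ hA.ne_zero ?_)
  rw [eB, sub_self, zero_mul] at hdisc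
  rw [← sub_eq_zero, ← mul_sub, ← hdisc]

/-- To add a point `P = (a, m)`, shift `B` by `cA` so that `B(a) = -m` and `C(a) = 0`, then move the
factor `λ - a` from `C` to `A`. The discriminant is unchanged. -/
theorem exists_isDivisorOf_interpolation (hD : D.Pairwise fun P Q => P ≠ hyperInv Q) :
    ∃ T : Triple, T.A.Monic ∧ T.A.natDegree = Multiset.card D ∧
      T.B.degree < T.A.degree ∧ T.disc = R ∧ IsDivisorOf T D := by
  induction D using Multiset.induction_on with
  | empty => exact ⟨⟨1, 0, -R⟩, by simp, by simp, by simp, by simp [Triple.disc],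
      by simp only [IsDivisorOf, Multiset.map_zero, roots_one]; rfl⟩
  | cons P D ih =>
    obtain ⟨hPD, hD'⟩ := pairwise_cons_iff.mp hD
    obtain ⟨T, hA, hAg, hB, hT, hTD⟩ := ih hD'
    have hroot : ∀ a, T.A.eval a = 0 ↔ ∃ Q ∈ D, Q.1.1 = a := by
      intro a
      rw [← Multiset.mem_map, hTD.map_fst, mem_roots hA.ne_zero]
      rfl
    have hdeg : ∀ c : ℂ, (T.B + C c * T.A).degree < (T.A * (X - C P.1.1)).degree := by
      intro c
      rw [degree_mul, degree_X_sub_C]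
      have hlt : T.A.degree < T.A.degree + 1 := by
        rw [degree_eq_natDegree hA.ne_zero]; exact_mod_cast Nat.lt_succ_self _
      refine lt_of_le_of_lt (degree_add_le _ _) (max_lt (hB.trans hlt) (lt_of_le_of_lt ?_ hlt))
      rw [degree_mul]
      exact (add_le_add_left degree_C_le _).trans (by simp)
    suffices H : ∃ c : ℂ, (T.B + C c * T.A).eval P.1.1 = -P.1.2 ∧
        (T.C + 2 * C c * T.B + C c ^ 2 * T.A).eval P.1.1 = 0 by
      obtain ⟨c, hc, hc'⟩ := H
      obtain ⟨C', hC'⟩ := dvd_iff_isRoot.mpr hc'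
      refine ⟨⟨T.A * (X - C P.1.1), T.B + C c * T.A, C'⟩, hA.mul (monic_X_sub_C _), ?_, hdeg c,
        ?_, isDivisorOf_of_map_fst ?_ ?_⟩
      · simp [hA.natDegree_mul (monic_X_sub_C _), hAg]
      · refine Eq.trans ?_ hT
        rw [Triple.disc, Triple.disc]
        linear_combination T.A * hC'
      · rw [roots_mul (mul_ne_zero hA.ne_zero (X_sub_C_ne_zero _)), ← hTD.map_fst, roots_X_sub_C,
          Multiset.map_cons, add_comm, Multiset.singleton_add]
      · intro Q hQ
        rcases Multiset.mem_cons.mp hQ with rfl | hQ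
        · rw [hc, neg_neg]
        · rw [eval_add, eval_mul, (hroot _).mpr ⟨Q, hQ, rfl⟩, mul_zero, add_zero, hTD.snd_eq hQ]
    have hdisc : T.B.eval P.1.1 ^ 2 - T.A.eval P.1.1 * T.C.eval P.1.1 = P.1.2 ^ 2 := by
      have := congrArg (eval P.1.1) hT
      rw [P.2, ← this, Triple.disc]; simp
    -- If `A(a) = 0`, then `P` already occurs in `D` and is not a branch point. The condition on `B`
    -- holds for every `c`, and the one on `C` is linear in `c` with coefficient `-2m ≠ 0`.
    by_cases h0 : T.A.eval P.1.1 = 0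
    · obtain ⟨Q, hQ, hQP⟩ := (hroot _).mp h0
      have hQeq := eq_of_mem_of_fst_eq hD (Multiset.mem_cons_of_mem hQ)
        (Multiset.mem_cons_self P D) hQP
      subst hQeq
      have hB' := hTD.snd_eq hQ
      have hm : Q.1.2 ≠ 0 := fun hm => hPD (by rwa [hyperInv_of_eq_zero hm])
      refine ⟨T.C.eval Q.1.1 / (2 * Q.1.2), ?_, ?_⟩
      · simp [h0, hB']
      · have : T.B.eval Q.1.1 = -Q.1.2 := by rw [hB', neg_neg]
        simp only [eval_add, eval_mul, eval_pow, eval_C, h0, this, eval_ofNat]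
        field_simp
        ring
    -- Here the condition on `B` fixes `c`, and the discriminant identity gives the condition on
    -- `C`.
    · refine ⟨(-P.1.2 - T.B.eval P.1.1) / T.A.eval P.1.1, ?_, ?_⟩
      · simp only [eval_add, eval_mul, eval_C]
        field_simp
        ring
      · apply mul_left_cancel₀ h0
        simp only [eval_add, eval_mul, eval_pow, eval_C, eval_ofNat]
        field_simp
        linear_combination -hdisc

end DivisorOfTriple

/-! ### Functions without poles on the affine curve -/

section Integrality

variable {g : ℕ} {R : ℂ[X]}

theorem exists_affPoint (R : ℂ[X]) (a : ℂ) : ∃ P : AffPoint R, P.1.1 = a := by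
  obtain ⟨m, hm⟩ := IsAlgClosed.exists_pow_nat_eq (R.eval a) two_pos
  exact ⟨⟨(a, m), hm⟩, rfl⟩

theorem exists_ofRat_eq_polyFun (hdeg : R.natDegree = 2 * g + 1) {u : RatFunc ℂ}
    (h : ∀ P : AffPoint R, IsRegularAt g (ofRat R u) (.aff P)) :
    ∃ p, ofRat R u = polyFun R p := by
  have hd : u.denom.degree = 0 := by
    by_contra h0
    obtain ⟨a, ha⟩ := IsAlgClosed.exists_root u.denom h0
    obtain ⟨P, rfl⟩ := exists_affPoint R a
    exact (h P).denom_eval_ne_zero hdeg ha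
  refine ⟨u.num, ?_⟩
  rw [← ofRat_algebraMap]
  congr 1
  nth_rw 1 [← RatFunc.num_div_denom u]
  rw [u.monic_denom.degree_le_zero_iff_eq_one.mp hd.le, map_one, div_one]

/-- For `F = u + vμ` with conjugate `F*`, the rational functions `2u = F + F*`, `2vR = (F - F*)μ`
and `4v²R = (F - F*)²` have no affine poles, so they are polynomials. -/
theorem exists_eq_polyFun_add_polyFun_mul_mu (hdeg : R.natDegree = 2 * g + 1)
    (hsq : Squarefree R) {F : FunField R} (h : ∀ P : AffPoint R, IsRegularAt g F (.aff P)) :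
    ∃ p q, F = polyFun R p + polyFun R q * mu R := by
  have hstar : ∀ P : AffPoint R, IsRegularAt g (star F) (.aff P) := fun P => by
    obtain ⟨c, hc⟩ := h (hyperInv P)
    have := hc.star
    rw [hyperInv_hyperInv] at this
    exact this.isRegularAt
  have hF := eq_ofRat_add_ofRat_mul_mu F
  generalize F.re = u, F.im = v at hF
  have hFs : star F = ofRat R u - ofRat R v * mu R := by
    rw [hF, star_add, star_mul', star_ofRat, star_ofRat, star_mu, mul_neg, sub_eq_add_neg]
  have hV : ∀ P : AffPoint R, IsRegularAt g (F - star F) (.aff P) := fun P => by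
    obtain ⟨c, hc⟩ := h P
    obtain ⟨c', hc'⟩ := hstar P
    exact (hc.sub hdeg hc').isRegularAt
  obtain ⟨p, hp⟩ : ∃ p, ofRat R (u + u) = polyFun R p :=
    exists_ofRat_eq_polyFun hdeg fun P => by
      convert (h P).add hdeg (hstar P) using 1
      rw [hFs, hF, ofRat_add]; ring
  obtain ⟨w, hw⟩ : ∃ w, ofRat R ((v + v) * algebraMap ℂ[X] (RatFunc ℂ) R) = polyFun R w :=
    exists_ofRat_eq_polyFun hdeg fun P => by
      convert (hV P).mul hdeg (hasValueAt_mu P).isRegularAt using 1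
      rw [hFs, hF, ofRat_mul, ← mu_mul_mu, ofRat_add]; ring
  obtain ⟨s, hs⟩ : ∃ s, ofRat R ((v + v) ^ 2 * algebraMap ℂ[X] (RatFunc ℂ) R) = polyFun R s :=
    exists_ofRat_eq_polyFun hdeg fun P => by
      convert (hV P).mul hdeg (hV P) using 1
      rw [hFs, hF, ofRat_mul, ← mu_mul_mu, ofRat_pow, ofRat_add]; ring
  have hws : w ^ 2 = R * s := by
    apply polyFun_injective (R := R)
    rw [map_pow, map_mul, ← hw, ← hs, ← ofRat_algebraMap, ← ofRat_pow, ← ofRat_mul]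
    ring_nf
  -- Squarefreeness enters here: `R ∣ w²` gives `R ∣ w`, so `2v = w/R` is a polynomial.
  obtain ⟨q, rfl⟩ : R ∣ w := (hsq.dvd_pow_iff_dvd two_ne_zero).mp ⟨s, hws⟩
  have hR0 : R ≠ 0 := hsq.ne_zero
  have hq : ofRat R (v + v) = polyFun R q := by
    apply polyFun_mul_cancel hR0
    rw [← map_mul, ← hw, ofRat_mul, ofRat_algebraMap, mul_comm]
  refine ⟨C (1 / 2) * p, C (1 / 2) * q, ?_⟩
  apply polyFun_mul_cancel (p := C 2) (C_ne_zero.mpr two_ne_zero)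
  have h2 : polyFun R (C 2) = 2 := by rw [C_ofNat, map_ofNat]
  have h12 : polyFun R (C 2) * polyFun R (C (1 / 2)) = 1 := by
    rw [← map_mul, ← C_mul]; norm_num
  rw [map_mul, map_mul, ← hp, ← hq, ofRat_add, ofRat_add]
  rw [mul_add, mul_assoc (polyFun R (C (1 / 2))), ← mul_assoc (polyFun R (C 2)), h12,
    ← mul_assoc (polyFun R (C 2)), h12, h2, hF]
  ring

theorem star_chartY_infty :
    star (chartY g (Point.infty : Point R)) = -chartY g (Point.infty : Point R) := by
  rw [chartY, star_mul', star_ofRat, star_mu, mul_neg]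

/-- Adding the conjugate isolates `2 x^(2g+1) R q`, with value `2`; subtracting it and squaring
isolates `4 x^(4g+2) R p²`, with value `0`. Each bounds a degree. -/
theorem eq_one_and_natDegree_le_of_hasValueAt_infty (hdeg : R.natDegree = 2 * g + 1)
    (hR : R.Monic) {p q : ℂ[X]}
    (h : HasValueAt g (ofRat R (RatFunc.X⁻¹ ^ g) * chartY g (Point.infty : Point R) *
      (polyFun R p + polyFun R q * mu R)) Point.infty 1) : q = 1 ∧ p.natDegree ≤ g := by
  set y := chartY g (Point.infty : Point R) with hy
  set x := ofRat R RatFunc.X⁻¹ with hx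
  have hyμ : y = x ^ (g + 1) * mu R := by rw [hy, chartY, ofRat_pow]
  have hμ := mu_sq (R := R)
  have hys : star y = -y := star_chartY_infty
  have hxs : star x = x := star_ofRat _
  have hs := h.star_infty
  rw [star_mul', star_mul', star_add, star_mul', star_polyFun, star_polyFun, star_mu, hys] at hs
  rw [ofRat_pow] at h hs
  rw [star_pow, hxs] at hs
  have hadd : HasValueAt g (ofRat R (RatFunc.X⁻¹ ^ (2 * g + 1)) * polyFun R (C 2 * (R * q)))
      Point.infty (1 + 1) := by
    convert h.add hdeg hs using 1
    rw [map_mul, map_mul, ← hμ, ofRat_pow, ← hx, C_ofNat, map_ofNat, hyμ]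
    ring
  have hsub : HasValueAt g (ofRat R (RatFunc.X⁻¹ ^ (4 * g + 2)) * polyFun R (C 4 * (p ^ 2 * R)))
      Point.infty ((1 - 1) * (1 - 1)) := by
    convert (h.sub hdeg hs).mul hdeg (h.sub hdeg hs) using 1
    rw [map_mul, map_mul, map_pow, ← hμ, ofRat_pow, ← hx, C_ofNat, map_ofNat, hyμ]
    ring
  constructor
  · have h1 := natDegree_le_of_hasValueAt_infty hdeg hadd
    have h2 := hadd.unique hdeg (hasValueAt_infty_polyFun h1)
    rw [coeff_C_mul] at h2
    have hq : q ≠ 0 := by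
      rintro rfl
      norm_num at h2
    rw [natDegree_C_mul two_ne_zero, hR.natDegree_mul' hq, hdeg] at h1
    rw [eq_C_of_natDegree_eq_zero (by omega : q.natDegree = 0)] at h2 ⊢
    rw [coeff_mul_C, ← hdeg, hR.coeff_natDegree] at h2
    rw [show q.coeff 0 = 1 by linear_combination -h2 / 2, C_1]
  · have h1 := natDegree_le_of_hasValueAt_infty hdeg hsub
    by_cases hp : p = 0
    · simp [hp]
    · rw [natDegree_C_mul (by norm_num : (4 : ℂ) ≠ 0), natDegree_mul (pow_ne_zero 2 hp) hR.ne_zero,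
        natDegree_pow, hdeg] at h1
      -- Parity: `2 deg p + 2g + 1 ≤ 4g + 2` implies `deg p ≤ g`.
      omega

end Integrality

/-! ### The functions with prescribed poles -/

section LSpace

variable {g : ℕ} {R : ℂ[X]} {T : Triple} {D : Multiset (AffPoint R)}

open Classical in
theorem IsDivisorOf.count_le_rootMultiplicity (h : IsDivisorOf T D) (P : AffPoint R) :
    D.count P ≤ T.A.rootMultiplicity P.1.1 := by
  rw [h.count_eq]
  split_ifs
  · exact le_rfl
  · exact Nat.zero_le _

/-- At a branch point over a root of `A`, `A f` is `μ · (μ f)` up to a unit. -/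
theorem polyFun_mul_eq_of_branch {p p₁ R₁ : ℂ[X]} {a : ℂ} (hR₁ : R = (X - C a) * R₁)
    (hp : p = (X - C a) * p₁) (f : FunField R) :
    polyFun R p * f * polyFun R R₁ = mu R * f * mu R * polyFun R p₁ := by
  have h1 : mu R ^ 2 = polyFun R (X - C a) * polyFun R R₁ := by
    rw [mu_sq, ← map_mul]; congr 1
  rw [hp, map_mul]
  linear_combination -f * polyFun R p₁ * h1

open Classical in
theorem isRegularAt_polyFun_mul (hdeg : R.natDegree = 2 * g + 1) (hsq : Squarefree R)
    (hD : D.Pairwise fun P Q => P ≠ hyperInv Q) (hA : T.A ≠ 0) (hTD : IsDivisorOf T D)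
    {f : FunField R} {P : AffPoint R} (hf : PoleOrderLE g f (.aff P) (D.count P)) :
    IsRegularAt g (polyFun R T.A * f) (.aff P) := by
  have hle := hTD.count_le_rootMultiplicity P
  by_cases hm : P.1.2 = 0
  · have h1 := count_le_one hD hm
    generalize D.count P = k at *
    obtain rfl | rfl : k = 0 ∨ k = 1 := by omega
    · rw [PoleOrderLE, pow_zero, one_mul] at hf
      exact (hasValueAt_polyFun P T.A).isRegularAt.mul hdeg hf
    · rw [PoleOrderLE, pow_one, localParam_aff_of_eq_zero hm] at hf
      obtain ⟨p₁, hp₁⟩ := dvd_iff_isRoot.mpr ((rootMultiplicity_pos hA).mp hle)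
      have hR0 : R.eval P.1.1 = 0 := by rw [← P.2, hm]; simp
      obtain ⟨R₁, hR₁⟩ := dvd_iff_isRoot.mpr hR0
      refine IsRegularAt.of_mul hdeg (eval_ne_zero_of_squarefree hsq hR₁)
        (hasValueAt_polyFun P R₁) ?_
      rw [polyFun_mul_eq_of_branch hR₁ hp₁]
      exact (hf.mul hdeg (hasValueAt_mu P).isRegularAt).mul hdeg
        (hasValueAt_polyFun P p₁).isRegularAt
  · rw [PoleOrderLE, localParam_aff_of_ne_zero hm, ← map_pow] at hf
    obtain ⟨p₁, hp₁⟩ := (le_rootMultiplicity_iff hA).mp hle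
    have := hf.mul hdeg (hasValueAt_polyFun P p₁).isRegularAt
    rwa [mul_right_comm, ← map_mul, ← hp₁] at this

theorem eq_phi_of_polyFun_mul_eq {B C' : ℂ[X]} {A : ℂ[X]} (hA : A ≠ 0) {f : FunField R}
    (h : polyFun R A * f = mu R - polyFun R B) : f = Triple.phi ⟨A, B, C'⟩ R := by
  apply polyFun_mul_cancel hA
  rw [h]
  exact (polyFun_A_mul_phi (T := ⟨A, B, C'⟩) hA).symm

-- The given triple serves to clear the poles of `f` with its `A`; the new `B` is read off from `A f
-- = μ - B`, and it remains to see that `A` divides `B² - R`.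
open Classical in
theorem exists_triple_of_poleOrderLE (hdeg : R.natDegree = 2 * g + 1) (hR : R.Monic)
    (hsq : Squarefree R) (hD : D.Pairwise fun P Q => P ≠ hyperInv Q) (hA : T.A.Monic)
    (hAg : T.A.natDegree = g) (hT : T.disc = R) (hTD : IsDivisorOf T D) {f : FunField R}
    (hf : ∀ P, PoleOrderLE g f (.aff P) (D.count P)) (hs : SimSqrt g f) :
    ∃ T' : Triple, T'.A = T.A ∧ T'.B.natDegree ≤ g ∧ T'.disc = R ∧ IsDivisorOf T' D ∧
      T'.phi R = f := by
  obtain ⟨p, q, hpq⟩ := exists_eq_polyFun_add_polyFun_mul_mu hdeg hsq fun P =>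
    isRegularAt_polyFun_mul hdeg hsq hD hA.ne_zero hTD (hf P)
  obtain ⟨rfl, hp⟩ : q = 1 ∧ p.natDegree ≤ g := by
    apply eq_one_and_natDegree_le_of_hasValueAt_infty hdeg hR
    rw [← hpq]
    rw [SimSqrt, localParam_infty] at hs
    have h1 := hasValueAt_infty_polyFun (g := g) (R := R) hAg.le
    have hc : T.A.coeff g = 1 := by rw [← hAg]; exact hA
    rw [hc] at h1
    convert h1.mul hdeg hs using 1
    · ring
    · ring
  obtain ⟨B, rfl⟩ : ∃ B, p = -B := ⟨-p, (neg_neg p).symm⟩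
  have hAf : polyFun R T.A * f = mu R - polyFun R B := by
    rw [hpq, map_neg, map_one]; ring
  have hval : ∀ Q : AffPoint R, HasValueAt g (polyFun R T.A * f) (.aff Q)
      (Q.1.2 - B.eval Q.1.1) := fun Q => by
    rw [hAf]
    exact (hasValueAt_mu Q).sub hdeg (hasValueAt_polyFun Q B)
  have hroot : ∀ P ∈ D, T.A.eval P.1.1 = 0 := fun P hP => by
    have := Multiset.mem_map_of_mem (fun P : AffPoint R => P.1.1) hP
    rw [hTD.map_fst] at this
    exact (mem_roots'.mp this).2
  have hreg : ∀ P ∈ D, P.1.2 ≠ 0 → IsRegularAt g f (.aff (hyperInv P)) := fun P hP hm => by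
    have := hf (hyperInv P)
    rwa [Multiset.count_eq_zero_of_notMem (hyperInv_notMem hD hP hm), PoleOrderLE, pow_zero,
      one_mul] at this
  have hsnd : ∀ P ∈ D, P.1.2 = -B.eval P.1.1 := by
    intro P hP
    by_cases hm : P.1.2 = 0
    · have h1 := hf P
      have hc : D.count P = 1 :=
        le_antisymm (count_le_one hD hm) (Multiset.one_le_count_iff_mem.mpr hP)
      rw [hc, PoleOrderLE, pow_one, localParam_aff_of_eq_zero hm] at h1
      obtain ⟨c, hc⟩ := h1
      obtain ⟨p₁, hp₁⟩ := dvd_iff_isRoot.mpr (hroot P hP)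
      have hR0 : R.eval P.1.1 = 0 := by rw [← P.2, hm]; simp
      obtain ⟨R₁, hR₁⟩ := dvd_iff_isRoot.mpr hR0
      have h2 := (hval P).mul hdeg (hasValueAt_polyFun P R₁)
      rw [polyFun_mul_eq_of_branch hR₁ hp₁] at h2
      -- At a branch point `A f · R₁ = μf · μ · p₁` vanishes since `μf` is regular; as `R₁` does not
      -- vanish, `B` does.
      have h3 := h2.unique hdeg
        ((hc.mul hdeg (hasValueAt_mu P)).mul hdeg (hasValueAt_polyFun P p₁))
      rw [hm, mul_zero, zero_mul, zero_sub] at h3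
      rw [hm]
      exact ((mul_eq_zero.mp h3).resolve_right (eval_ne_zero_of_squarefree hsq hR₁)).symm
    -- At `τ(P)` the function `f` is regular and `A` vanishes, hence so does `μ - B`.
    · obtain ⟨c, hc⟩ := hreg P hP hm
      have h1 := ((hasValueAt_polyFun _ T.A).mul hdeg hc).unique hdeg (hval (hyperInv P))
      simp only [hyperInv] at h1
      rw [hroot P hP, zero_mul] at h1
      linear_combination h1
  have hdvd : T.A ∣ B ^ 2 - R := by
    refine dvd_of_pow_rootMultiplicity_dvd hA.ne_zero fun a ha => ?_
    have hmem : a ∈ T.A.roots := (mem_roots hA.ne_zero).mpr ha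
    rw [← hTD.map_fst, Multiset.mem_map] at hmem
    obtain ⟨P, hP, rfl⟩ := hmem
    by_cases hm : P.1.2 = 0
    · have h1 := hTD.snd_eq hP
      refine (pow_dvd_pow _ (rootMultiplicity_le_one hsq hT hA.ne_zero
        (neg_eq_zero.mp (h1.symm.trans hm)))).trans ?_
      rw [pow_one, dvd_iff_isRoot, IsRoot.def, eval_sub, eval_pow, ← P.2, hsnd P hP]
      ring
    · have hA0 := RatFunc.algebraMap_ne_zero hA.ne_zero
      set u : RatFunc ℂ := algebraMap ℂ[X] (RatFunc ℂ) (R - B ^ 2) /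
        algebraMap ℂ[X] (RatFunc ℂ) T.A with hu
      -- The function `f(μ + B) = (R - B²)/A` depends on `λ` alone and is regular at `τ(P)`, so its
      -- reduced denominator is nonzero at `a`. This gives divisibility with full multiplicity.
      have hfu : f * (mu R + polyFun R B) = ofRat R u := by
        apply polyFun_mul_cancel hA.ne_zero
        rw [← mul_assoc, hAf, ← ofRat_algebraMap T.A, ← ofRat_mul, hu, mul_div_cancel₀ _ hA0,
          ofRat_algebraMap, map_sub, map_pow, ← mu_sq]
        ring
      have h1 := (hreg P hP hm).mul hdeg
        ((hasValueAt_mu _).add hdeg (hasValueAt_polyFun _ B)).isRegularAt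
      rw [hfu] at h1
      have h2 := h1.denom_eval_ne_zero hdeg
      have h3 : u.num * T.A = (R - B ^ 2) * u.denom :=
        (RatFunc.num_mul_eq_mul_denom_iff hA.ne_zero).mpr hu
      refine (isCoprime_X_sub_C_pow h2 _).dvd_of_dvd_mul_right
        ((pow_rootMultiplicity_dvd T.A P.1.1).trans ⟨-u.num, ?_⟩)
      linear_combination h3
  obtain ⟨C', hC'⟩ := hdvd
  refine ⟨⟨T.A, B, C'⟩, rfl, by simpa using hp, ?_, isDivisorOf_of_map_fst hTD.map_fst hsnd,
    (eq_phi_of_polyFun_mul_eq hA.ne_zero hAf).symm⟩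
  rw [Triple.disc]
  linear_combination hC'

end LSpace

/-! ### The triple variety -/

section TripleVariety

variable {g : ℕ} {R : ℂ[X]} {α : Fin (2 * g + 1) → ℂ} {T : Triple} {D : Multiset (AffPoint R)}

/-- The conditions on `C` are automatic: `-AC = R - B²` is monic of degree `2g + 1` because `deg B²
≤ 2g`. -/
theorem mem_tripleVariety (hadm : IsAdmissible α R) (hA : T.A.Monic) (hAg : T.A.natDegree = g)
    (hB : T.B.natDegree ≤ g) (hT : T.disc = R) : T ∈ tripleVariety α R := by
  obtain ⟨hR, hdeg⟩ := hadm.monic_and_natDegree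
  have h1 : (T.B ^ 2).degree < R.degree := by
    rw [degree_eq_natDegree hR.ne_zero, hdeg]
    refine lt_of_le_of_lt degree_le_natDegree ?_
    have := natDegree_pow_le (p := T.B) (n := 2)
    exact_mod_cast (by omega : (T.B ^ 2).natDegree < 2 * g + 1)
  have h2 : (R - T.B ^ 2).Monic := hR.sub_of_left h1
  have h3 : (R - T.B ^ 2).natDegree = 2 * g + 1 := by
    rw [natDegree_eq_of_degree_eq (degree_sub_eq_left_of_degree_lt h1), hdeg]
  have h4 : R - T.B ^ 2 = T.A * -T.C := by
    have := hT
    rw [Triple.disc] at this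
    linear_combination -this
  rw [h4] at h2 h3
  have h5 : (-T.C).Monic := hA.of_mul_monic_left h2
  rw [hA.natDegree_mul h5, hAg, natDegree_neg] at h3
  refine ⟨⟨hA, hAg, ?_, by omega, hB, hT ▸ hadm⟩, hT⟩
  rw [Monic, leadingCoeff_neg] at h5
  linear_combination -h5

/-- Adding a multiple of `A` to `B`, without changing the discriminant. -/
def Triple.shift (T : Triple) (c : ℂ) : Triple :=
  ⟨T.A, T.B + Polynomial.C c * T.A, T.C + 2 * Polynomial.C c * T.B + Polynomial.C c ^ 2 * T.A⟩

theorem disc_shift (c : ℂ) : (T.shift c).disc = T.disc := by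
  rw [Triple.disc, Triple.disc, Triple.shift]
  ring

theorem shift_mem_tripleVariety (hadm : IsAdmissible α R) (hT : T ∈ tripleVariety α R) (c : ℂ) :
    T.shift c ∈ tripleVariety α R := by
  refine mem_tripleVariety hadm hT.1.monic_A hT.1.natDegree_A ?_ ((disc_shift c).trans hT.2)
  refine (natDegree_add_le_of_degree_le hT.1.natDegree_B ?_)
  exact (natDegree_C_mul_le _ _).trans hT.1.natDegree_A.le

theorem coeff_B_shift (hT : T ∈ tripleVariety α R) (c : ℂ) :
    (T.shift c).B.coeff g = T.B.coeff g + c := by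
  have : T.A.coeff g = 1 := by
    have h := hT.1.monic_A
    rwa [Monic, leadingCoeff, hT.1.natDegree_A] at h
  simp [Triple.shift, this]

theorem IsDivisorOf.shift (h : IsDivisorOf T D) (c : ℂ) : IsDivisorOf (T.shift c) D := by
  refine isDivisorOf_of_map_fst h.map_fst fun P hP => ?_
  have := Multiset.mem_map_of_mem (fun P : AffPoint R => P.1.1) hP
  rw [h.map_fst] at this
  simp [Triple.shift, (mem_roots'.mp this).2.eq_zero, h.snd_eq hP]

theorem exists_mem_tripleVariety (hadm : IsAdmissible α R) (hD : IsNonSpecial g D) (β : ℂ) :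
    ∃ T ∈ tripleVariety α R, IsDivisorOf T D ∧ T.B.coeff g = β := by
  obtain ⟨hc, hD⟩ := isNonSpecial_iff.mp hD
  obtain ⟨T, hA, hAg, hB, hT, hTD⟩ := exists_isDivisorOf_interpolation hD
  have hmem := mem_tripleVariety hadm hA (hAg.trans hc)
    ((natDegree_le_natDegree hB.le).trans (hAg.trans hc).le) hT
  exact ⟨T.shift (β - T.B.coeff g), shift_mem_tripleVariety hadm hmem _, hTD.shift _,
    by rw [coeff_B_shift hmem]; ring⟩

theorem exists_isDivisorOf_affJac (hsq : Squarefree R) (hT : T ∈ tripleVariety α R) :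
    ∃ D : AffJac g R, IsDivisorOf T D.1 := by
  obtain ⟨D, hD⟩ := exists_isDivisorOf hT.2
  exact ⟨⟨D, hD.isNonSpecial hsq hT.1.monic_A.ne_zero hT.2 hT.1.natDegree_A⟩, hD⟩

/-- The bijection `T ↦ (D_T, β_T)`. -/
theorem exists_tripleVariety_equiv (hadm : IsAdmissible α R) (hsq : Squarefree R) :
    ∃ Φ : tripleVariety α R ≃ AffJac g R × ℂ,
      ∀ T, IsDivisorOf T.1 (Φ T).1.1 ∧ (Φ T).2 = T.1.B.coeff g := by
  choose d hd using fun T : tripleVariety α R => exists_isDivisorOf_affJac hsq T.2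
  refine ⟨Equiv.ofBijective (fun T => (d T, T.1.B.coeff g)) ⟨fun T T' h => ?_, ?_⟩,
    fun T => ⟨hd T, rfl⟩⟩
  · obtain ⟨h1, h2⟩ := Prod.mk.inj h
    have hg := T.2.1.natDegree_A
    apply Subtype.ext
    have hB := T.2.1.natDegree_B.trans hg.ge
    have hB' := T'.2.1.natDegree_B.trans hg.ge
    refine eq_of_isDivisorOf (R := R) (D := (d T).1) hsq T.2.1.monic_A T'.2.1.monic_A T.2.2 T'.2.2
      hB hB' (hd T) (h1 ▸ hd T') ?_
    rw [hg]
    exact h2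
  · rintro ⟨D, β⟩
    obtain ⟨T, hT, hTD, hβ⟩ := exists_mem_tripleVariety hadm D.2 β
    exact ⟨⟨T, hT⟩, Prod.ext (Subtype.ext ((hd ⟨T, hT⟩).unique hTD)) hβ⟩

theorem simSqrt_phi_of_mem (hadm : IsAdmissible α R) (hT : T ∈ tripleVariety α R) :
    SimSqrt g (T.phi R) := by
  obtain ⟨hR, hdeg⟩ := hadm.monic_and_natDegree
  exact simSqrt_phi hdeg hR hT.1.monic_A hT.1.natDegree_A hT.1.natDegree_B

theorem HasPoleDivisor.mem_lSpace {f : FunField R} {E : Multiset (Point R)}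
    (h : HasPoleDivisor g f E) : f ∈ LSpace g E :=
  fun P => (h P).1

theorem exists_triple_of_mem_lSpace (hadm : IsAdmissible α R) (hsq : Squarefree R)
    {D : AffJac g R} {f : FunField R} (hf : f ∈ LSpace g D.addInfty) (hs : SimSqrt g f) :
    ∃ T ∈ tripleVariety α R, IsDivisorOf T D.1 ∧ T.phi R = f := by
  classical
  obtain ⟨hR, hdeg⟩ := hadm.monic_and_natDegree
  obtain ⟨T₀, hT₀, hTD₀, -⟩ := exists_mem_tripleVariety hadm D.2 0
  have hinj : Function.Injective (Point.aff : AffPoint R → Point R) :=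
    fun P Q h => Point.aff.inj h
  obtain ⟨T, hA, hB, hT, hTD, hphi⟩ := exists_triple_of_poleOrderLE hdeg hR hsq
    (isNonSpecial_iff.mp D.2).2 hT₀.1.monic_A hT₀.1.natDegree_A hT₀.2 hTD₀ (f := f) (fun P => by
      have h := hf (.aff P)
      have hc : D.addInfty.count (Point.aff P) = D.1.count P := by
        rw [AffJac.addInfty, Multiset.count_cons_of_ne (by simp),
          Multiset.count_map_eq_count' _ _ hinj]
      rw [← hc]
      convert h) hs
  exact ⟨T, mem_tripleVariety hadm (hA ▸ hT₀.1.monic_A) (hA ▸ hT₀.1.natDegree_A) hB hT, hTD, hphi⟩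

end TripleVariety

/-! ### The pure periodic case -/

theorem ncard_quadratic_of_ne_zero {a b c r : ℂ} (ha : a ≠ 0) (hr : r ≠ 0)
    (h : b ^ 2 - a * c = r) : {x : ℂ | c + 2 * x * b + x ^ 2 * a = 0}.ncard = 2 := by
  obtain ⟨s, hs⟩ := IsAlgClosed.exists_pow_nat_eq r two_pos
  have hs0 : s ≠ 0 := by rintro rfl; simp at hs; exact hr hs.symm
  have : {x : ℂ | c + 2 * x * b + x ^ 2 * a = 0} = {(-b + s) / a, (-b - s) / a} := by
    ext x
    simp only [Set.mem_ofPred_eq, Set.mem_insert_iff, Set.mem_singleton_iff, eq_div_iff ha]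
    have key : a * (c + 2 * x * b + x ^ 2 * a) = (x * a - (-b + s)) * (x * a - (-b - s)) := by
      linear_combination -h + hs
    rw [← sub_eq_zero (b := -b + s), ← sub_eq_zero (b := -b - s), ← mul_eq_zero, ← key,
      mul_eq_zero, or_iff_right ha]
  rw [this, Set.ncard_pair]
  intro h'
  rw [div_left_inj' ha] at h'
  exact hs0 (self_eq_neg.mp (by linear_combination h'))

theorem ncard_linear {b c : ℂ} (hb : b ≠ 0) :
    {x : ℂ | c + 2 * x * b + x ^ 2 * 0 = 0}.ncard = 1 := by
  rw [Set.ncard_eq_one]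
  refine ⟨-c / (2 * b), ?_⟩
  ext x
  simp only [Set.mem_ofPred_eq, Set.mem_singleton_iff, eq_div_iff (mul_ne_zero two_ne_zero hb)]
  exact ⟨fun h => by linear_combination h, fun h => by linear_combination h⟩

section Pure

variable {g : ℕ} {R : ℂ[X]} {α : Fin (2 * g + 1) → ℂ}

/-- The pure triples with divisor `D` are obtained from one triple with this divisor by the
shifts whose parameter solves a quadratic equation. -/
theorem ncard_pure_fibre (hadm : IsAdmissible α R) (Φ : tripleVariety α R ≃ AffJac g R × ℂ)
    (hΦ : ∀ T, IsDivisorOf T.1 (Φ T).1.1 ∧ (Φ T).2 = T.1.B.coeff g)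
    {D : AffJac g R} {T₀ : Triple} (hT₀ : T₀ ∈ tripleVariety α R) (hD : IsDivisorOf T₀ D.1) :
    {T : tripleVariety α R | T.1 ∈ pureTripleVariety α R ∧ (Φ T).1 = D}.ncard =
      {x : ℂ | T₀.C.eval (lastParam α) + 2 * x * T₀.B.eval (lastParam α) +
        x ^ 2 * T₀.A.eval (lastParam α) = 0}.ncard := by
  let s : ℂ → tripleVariety α R := fun x => ⟨T₀.shift x, shift_mem_tripleVariety hadm hT₀ x⟩
  have hs : ∀ x, Φ (s x) = (D, T₀.B.coeff g + x) := fun x => by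
    refine Prod.ext (Subtype.ext ((hΦ (s x)).1.unique (hD.shift x))) ?_
    rw [(hΦ (s x)).2]
    exact coeff_B_shift hT₀ x
  have hinj : Function.Injective s := fun x y h => by
    have := congrArg Prod.snd ((hs x).symm.trans ((congrArg Φ h).trans (hs y)))
    exact add_left_cancel this
  have hC : ∀ x, (s x).1.C.eval (lastParam α) = T₀.C.eval (lastParam α) +
      2 * x * T₀.B.eval (lastParam α) + x ^ 2 * T₀.A.eval (lastParam α) := fun x => by
    simp [s, Triple.shift]
  rw [← Set.ncard_image_of_injective _ hinj]
  congr 1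
  ext T
  constructor
  · rintro ⟨hT, hTD⟩
    have e : s ((Φ T).2 - T₀.B.coeff g) = T := by
      apply Φ.injective
      rw [hs, ← hTD]
      exact Prod.ext rfl (by ring)
    refine ⟨_, ?_, e⟩
    rw [Set.mem_ofPred_eq, ← hC, e]
    exact hT.2
  · rintro ⟨x, hx, rfl⟩
    rw [Set.mem_ofPred_eq, ← hC] at hx
    exact ⟨⟨(s x).2, hx⟩, by rw [hs]⟩

end Pure

end AlphaFraction

end

theorem theorem3 (g : ℕ) (α : Fin (2 * g + 1) → ℂ) (R : Polynomial ℂ)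
    (hR : IsAdmissible α R) (hroots : R.roots.Nodup) :
    ∃ Φ : tripleVariety α R ≃ AffJac g R × ℂ,
      -- the bijection sends a triple to the pole divisor of its function and to `β`
      (∀ T : tripleVariety α R,
        (Φ T).1.1.map Subtype.val = T.1.A.roots.map (fun a => (a, -T.1.B.eval a)) ∧
        (Φ T).2 = T.1.B.coeff g ∧
        HasPoleDivisor g (T.1.phi R) (Φ T).1.addInfty ∧
        SimSqrt g (T.1.phi R)) ∧
      -- a triple is determined by its function
      (∀ T T' : tripleVariety α R, T.1.phi R = T'.1.phi R → T = T') ∧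
      -- characterisation of the functions with a given divisor
      (∀ D : AffJac g R,
        {f : FunField R | ∃ T : tripleVariety α R, (Φ T).1 = D ∧ T.1.phi R = f} =
          {f : FunField R | f ∈ LSpace g D.addInfty ∧ SimSqrt g f}) ∧
      -- characterisation of all the functions
      {f : FunField R | ∃ T : tripleVariety α R, T.1.phi R = f} =
        {f : FunField R | (∃ D : AffJac g R, HasPoleDivisor g f D.addInfty) ∧ SimSqrt g f} ∧
      -- the pure periodic case
      (R.eval (lastParam α) ≠ 0 →
        (∀ D : AffJac g R,
          ((∀ P ∈ D.1, P.1.1 ≠ lastParam α) →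
            {T : tripleVariety α R | T.1 ∈ pureTripleVariety α R ∧ (Φ T).1 = D}.ncard = 2) ∧
          ((∃ P ∈ D.1, P.1.1 = lastParam α) →
            {T : tripleVariety α R | T.1 ∈ pureTripleVariety α R ∧ (Φ T).1 = D}.ncard = 1)) ∧
        (∀ D : AffJac g R,
          {f : FunField R | ∃ T : tripleVariety α R,
              T.1 ∈ pureTripleVariety α R ∧ (Φ T).1 = D ∧ T.1.phi R = f} =
            {f : FunField R | f ∈ LSpace g D.addInfty ∧ SimSqrt g f ∧
              ∃ P : AffPoint R, P.1.1 = lastParam α ∧ HasValueAt g f (Point.aff P) 0})) := by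
  classical
  obtain ⟨hmonic, hdeg⟩ := hR.monic_and_natDegree
  have hsq := squarefree_of_nodup_roots hmonic.ne_zero hroots
  obtain ⟨Φ, hΦ⟩ := exists_tripleVariety_equiv hR hsq
  have hpole : ∀ T : tripleVariety α R, HasPoleDivisor g (T.1.phi R) (Φ T).1.addInfty := fun T =>
    (hΦ T).1.hasPoleDivisor hdeg hsq T.2.1.monic_A.ne_zero T.2.2 (simSqrt_phi_of_mem hR T.2)
  have hsim : ∀ T : tripleVariety α R, SimSqrt g (T.1.phi R) := fun T => simSqrt_phi_of_mem hR T.2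
  have hspace : ∀ (D : AffJac g R) (f : FunField R),
      (∃ T : tripleVariety α R, (Φ T).1 = D ∧ T.1.phi R = f) ↔
        f ∈ LSpace g D.addInfty ∧ SimSqrt g f := by
    intro D f
    constructor
    · rintro ⟨T, rfl, rfl⟩
      exact ⟨(hpole T).mem_lSpace, hsim T⟩
    · rintro ⟨hf, hs⟩
      obtain ⟨T, hT, hTD, hphi⟩ := exists_triple_of_mem_lSpace hR hsq hf hs
      exact ⟨⟨T, hT⟩, Subtype.ext ((hΦ ⟨T, hT⟩).1.unique hTD), hphi⟩
  refine ⟨Φ, fun T => ⟨(hΦ T).1, (hΦ T).2, hpole T, hsim T⟩, fun T T' h => ?_,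
    fun D => Set.ext (hspace D), ?_, fun hα => ⟨fun D => ?_, fun D => ?_⟩⟩
  · exact Subtype.ext (phi_injective T.2.1.monic_A.ne_zero T.2.2 T'.2.2 h)
  · ext f
    constructor
    · rintro ⟨T, rfl⟩
      exact ⟨⟨_, hpole T⟩, hsim T⟩
    · rintro ⟨⟨D, hD⟩, hs⟩
      obtain ⟨T, -, hT⟩ := (hspace D f).mpr ⟨hD.mem_lSpace, hs⟩
      exact ⟨T, hT⟩
  · obtain ⟨T₀, hT₀, hTD, -⟩ := exists_mem_tripleVariety hR D.2 0
    have hdisc : T₀.B.eval (lastParam α) ^ 2 -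
        T₀.A.eval (lastParam α) * T₀.C.eval (lastParam α) = R.eval (lastParam α) := by
      rw [← hT₀.2, Triple.disc]; simp
    have hroot : T₀.A.eval (lastParam α) = 0 ↔ ∃ P ∈ D.1, P.1.1 = lastParam α := by
      rw [← Multiset.mem_map, hTD.map_fst, Polynomial.mem_roots hT₀.1.monic_A.ne_zero]
      rfl
    -- It remains to count the roots of a quadratic whose leading coefficient `A(α_N)` vanishes
    -- exactly when a point of `D` lies over `α_N`; then `B(α_N)² = R(α_N) ≠ 0` makes it genuinely
    -- linear.
    rw [ncard_pure_fibre hR Φ hΦ hT₀ hTD]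
    constructor
    · intro h
      refine ncard_quadratic_of_ne_zero (fun h0 => ?_) hα hdisc
      obtain ⟨P, hP, hP'⟩ := hroot.mp h0
      exact h P hP hP'
    · intro h
      rw [hroot.mpr h]
      rw [hroot.mpr h] at hdisc
      refine ncard_linear fun h0 => hα ?_
      rw [← hdisc, h0]
      ring
  · ext f
    constructor
    · rintro ⟨T, hT, hD, rfl⟩
      obtain ⟨h1, h2⟩ := (hspace D _).mp ⟨T, hD, rfl⟩
      exact ⟨h1, h2, (exists_hasValueAt_phi_zero_iff hdeg T.2.1.monic_A.ne_zero T.2.2 hα).mpr hT.2⟩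
    · rintro ⟨h1, h2, h3⟩
      obtain ⟨T, hD, rfl⟩ := (hspace D f).mpr ⟨h1, h2⟩
      exact ⟨T, ⟨T.2, (exists_hasValueAt_phi_zero_iff hdeg T.2.1.monic_A.ne_zero T.2.2 hα).mp h3⟩,
        hD, rfl⟩
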